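/- Notation. Let $N\ge 1$, write $e(x)=\exp(2\pi i x)$, $L[s]=s^{\mathrm{tr}}Ls$. For $k\in\mathbb Z$ and a symmetric integral $N\times N$ matrix $L$ with even diagonal entries that is positive definite, $J_{k,L}$ denotes the space of Jacobi forms of weight $k$ and index $L$: holomorphic $\phi:\mathbb H\times\mathbb C^N\to\mathbb C$ such that $$(c\tau+d)^{-k}\,e\Big(-\frac{c\,L[z+\lambda\tau+\mu]}{2(c\tau+d)}+\frac{\tau L[\lambda]}{2}+\lambda^{\mathrm{tr}}Lz\Big)\,\phi\Big(\frac{a\tau+b}{c\tau+d},\frac{z+\lambda\tau+\mu}{c\tau+d}\Big)=\phi(\tau,z)$$ for all $\begin{pmatrix}a&b\\c&d\end{pmatrix}\in\mathrm{SL}_2(\mathbb Z)$, $\lambda,\mu\in\mathbb Z^N$, and such that $e(\tau L[\alpha]/2)\,\phi(\tau,\alpha\tau+\beta)$ is bounded as $\mathrm{Im}\,\tau\to\infty$ for all $\alpha,\beta\in\mathbb Q^N$. For an integral matrix $s$ with $N$ rows put $\phi[s](\tau,z)=\phi(\tau,sz)$; for square $s$ this is also written $\phi|U_s$. If $l$ is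 an integer and the index is scalar, $U_l$ is $\phi(\tau,z)\mapsto\phi(\tau,lz)$. Test sets. Let $\tilde s$ be an integral $N\times N$ matrix with $\det\tilde s\neq0$, and let $L$ be as above. Let $\mathcal R\subset\mathbb Z^N$ be a system of representatives of $(\mathbb Z^N/L\mathbb Z^N)/\{\pm1\}$ such that each $r\in\mathcal R$ has minimal norm $L^{-1}[r]$ in $r+L\mathbb Z^N$, put $\mathrm{neigh}(r)=\{r'\in r+L\mathbb Z^N: L^{-1}[r']=L^{-1}[r]\}$ and $\mathcal M=\bigcup_{r\in\mathcal R}\mathrm{neigh}(r)\cup\mathrm{neigh}(-r)$. Let $l>0$ be an integer with $l\mathbb Z^N\subseteq\tilde s\mathbb Z^N$. For each $r\in\mathcal R$ let $\mathcal T(r)\subset\mathbb Z^N\setminus\{0\}$ be a finite set that spans $\mathbb Z^N$ and such that, for every $s'\in\mathcal T(r)$, the vector $s=l\tilde s^{-1}s'$ has the property: if $r'\in\mathcal M$ and $s^{\mathrm{tr}}r'=s^{\mathrm{tr}}r$, then $r'=r$. A finite set of the form $$\mathcal S=\bigcup_{r\in\mathcal R}\{\,l\tilde s^{-1}s' : s'\in\mathcal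 T(r)\,\}\subset\mathbb Z^N$$ is called a test set for $(L,\tilde s)$. Theorem. Let $L$ be a symmetric, positive definite integral $N\times N$ matrix with even diagonal entries, and suppose that $L=L'[\tilde s]$ with integral $N\times N$ matrices $\tilde s$ and $L'$, where $L'$ has even diagonal entries. Then there is a test set for $(L,\tilde s)$, and every test set $\mathcal S$ has the following property. For $s\in\mathcal S$ let $l_s$ be the greatest common divisor of the entries of $\tilde s s$. For every $k\in\mathbb Z$ and every $0\neq\phi\in J_{k,L}$: if $\phi[s]\in J_{k,L[s]/l_s^2}\,|\,U_{l_s}$ for all $s\in\mathcal S$, then $\phi\in J_{k,L'}\,|\,U_{\tilde s}$. -/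

import Mathlib

open scoped UpperHalfPlane MatrixGroups

noncomputable section

/-- `e(x) = exp(2 π i x)`. -/
def expTwoPiI (x : ℂ) : ℂ := Complex.exp (2 * Real.pi * Complex.I * x)

/-- `L[s] = sᵗ L s` for integral matrices of compatible size. -/
def gramPullback {N M : ℕ} (L : Matrix (Fin N) (Fin N) ℤ) (s : Matrix (Fin N) (Fin M) ℤ) :
    Matrix (Fin M) (Fin M) ℤ :=
  s.transpose * L * s

/-- The complex bilinear form `xᵗ L y` attached to an integral matrix `L`. -/
def bilin {N : ℕ} (L : Matrix (Fin N) (Fin N) ℤ) (x y : Fin N → ℂ) : ℂ :=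
  dotProduct x ((L.map (Int.cast : ℤ → ℂ)).mulVec y)

/-- `L` is the Gram matrix of an even positive definite lattice: symmetric, integral, with even
diagonal entries, positive definite. -/
structure IsJacobiIndex {N : ℕ} (L : Matrix (Fin N) (Fin N) ℤ) : Prop where
  symm : L.IsSymm
  even : ∀ i, Even (L i i)
  posDef : (L.map (Int.cast : ℤ → ℝ)).PosDef

/-- The weight `k`, index `L` slash action of `(γ, (lam, mu))` in the full Jacobi group. -/
def jacobiSlash {N : ℕ} (k : ℤ) (L : Matrix (Fin N) (Fin N) ℤ) (φ : ℍ × (Fin N → ℂ) → ℂ)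
    (γ : SL(2, ℤ)) (lam mu : Fin N → ℤ) (p : ℍ × (Fin N → ℂ)) : ℂ :=
  let τ : ℂ := p.1
  let z : Fin N → ℂ := p.2
  let c : ℂ := (γ 1 0 : ℤ)
  let d : ℂ := (γ 1 1 : ℤ)
  let l : Fin N → ℂ := fun i => lam i
  let w : Fin N → ℂ := fun i => z i + lam i * τ + mu i
  (c * τ + d) ^ (-k) *
    expTwoPiI (-c * bilin L w w / (2 * (c * τ + d)) + τ * bilin L l l / 2 + bilin L l z) *
    φ (γ • p.1, fun i => w i / (c * τ + d))

/-- `φ` is a (holomorphic) Jacobi form of weight `k` and index `L`.  The growth condition says that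
`φ |_L (α, β)`, evaluated at `z = 0`, stays bounded as `Im τ → ∞`, for all rational `α`, `β`. -/
structure IsJacobiForm {N : ℕ} (k : ℤ) (L : Matrix (Fin N) (Fin N) ℤ)
    (φ : ℍ × (Fin N → ℂ) → ℂ) : Prop where
  holo : DifferentiableOn ℂ
    (fun p : ℂ × (Fin N → ℂ) => φ (UpperHalfPlane.ofComplex p.1, p.2)) {p | 0 < p.1.im}
  slash_eq : ∀ (γ : SL(2, ℤ)) (lam mu : Fin N → ℤ), jacobiSlash k L φ γ lam mu = φ
  growth : ∀ α β : Fin N → ℚ, UpperHalfPlane.IsBoundedAtImInfty fun τ : ℍ =>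
    expTwoPiI ((τ : ℂ) * bilin L (fun i => (α i : ℂ)) (fun i => (α i : ℂ)) / 2) *
      φ (τ, fun i => (α i : ℂ) * (τ : ℂ) + (β i : ℂ))

/-- The space `J_{k,L}`. -/
def jacobiForms {N : ℕ} (k : ℤ) (L : Matrix (Fin N) (Fin N) ℤ) : Set (ℍ × (Fin N → ℂ) → ℂ) :=
  {φ | IsJacobiForm k L φ}

/-- The pullback `φ[s](τ, z) = φ(τ, s z)`.  For square `s` this is the operator `U_s`. -/
def jacobiPullback {N M : ℕ} (φ : ℍ × (Fin N → ℂ) → ℂ) (s : Matrix (Fin N) (Fin M) ℤ) :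
    ℍ × (Fin M → ℂ) → ℂ :=
  fun p => φ (p.1, (s.map (Int.cast : ℤ → ℂ)).mulVec p.2)

/-- The space `J_{k,L} | U_s`. -/
def jacobiFormsU {N : ℕ} (k : ℤ) (L s : Matrix (Fin N) (Fin N) ℤ) :
    Set (ℍ × (Fin N → ℂ) → ℂ) :=
  (fun φ => jacobiPullback φ s) '' jacobiForms k L

/-- A vector of `ℤ^N` as an `N × 1` matrix. -/
def colVec {N : ℕ} (s : Fin N → ℤ) : Matrix (Fin N) (Fin 1) ℤ := Matrix.of fun i _ => s i

/-- `l_s`, the nonnegative greatest common divisor of the entries of `st * s`. -/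
def contentOf {N : ℕ} (st : Matrix (Fin N) (Fin N) ℤ) (s : Fin N → ℤ) : ℤ :=
  Finset.univ.gcd (st.mulVec s)

/-- The scalar index `L[s] / l_s²`, as a `1 × 1` matrix.  The division is exact if `L = L'[st]`,
see `contentOf_sq_mul_scalarIndex`. -/
def scalarIndex {N : ℕ} (L st : Matrix (Fin N) (Fin N) ℤ) (s : Fin N → ℤ) :
    Matrix (Fin 1) (Fin 1) ℤ :=
  !![gramPullback L (colVec s) 0 0 / contentOf st s ^ 2]

/-- The norm `L⁻¹[r]` on `ℤ^N`, viewed as the dual of the lattice with Gram matrix `L`. -/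
def dualNorm {N : ℕ} (L : Matrix (Fin N) (Fin N) ℤ) (r : Fin N → ℤ) : ℚ :=
  dotProduct (fun i => (r i : ℚ)) ((L.map (Int.cast : ℤ → ℚ))⁻¹.mulVec fun i => (r i : ℚ))

/-- `R` is a system of representatives of `(ℤ^N / L ℤ^N) / {±1}` whose elements `r` have minimal
norm in `r + L ℤ^N`. -/
structure IsMinimalRepSystem {N : ℕ} (L : Matrix (Fin N) (Fin N) ℤ)
    (R : Finset (Fin N → ℤ)) : Prop where
  existsUnique : ∀ v : Fin N → ℤ, ∃! r, r ∈ R ∧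
    ∃ lam : Fin N → ℤ, v = r + L.mulVec lam ∨ v = -r + L.mulVec lam
  minimal : ∀ r ∈ R, ∀ lam : Fin N → ℤ, dualNorm L r ≤ dualNorm L (r + L.mulVec lam)

/-- `neigh(r)`: the vectors in `r + L ℤ^N` of the same norm as `r`. -/
def neigh {N : ℕ} (L : Matrix (Fin N) (Fin N) ℤ) (r : Fin N → ℤ) : Set (Fin N → ℤ) :=
  {r' | (∃ lam : Fin N → ℤ, r' = r + L.mulVec lam) ∧ dualNorm L r' = dualNorm L r}

/-- `T` is a strong set of restriction vectors at `r`: it consists of nonzero vectors, spans `ℤ^N`,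
and for every `s'` in `T` the vector `s = l st⁻¹ s'` separates `r` from all other elements of
`neigh(r₀) ∪ neigh(-r₀)`, `r₀` in `R`. -/
structure IsStrongRestrictionSet {N : ℕ} (L st : Matrix (Fin N) (Fin N) ℤ) (l : ℤ)
    (R : Finset (Fin N → ℤ)) (r : Fin N → ℤ) (T : Finset (Fin N → ℤ)) : Prop where
  ne_zero : ∀ s' ∈ T, s' ≠ 0
  span_eq_top : Submodule.span ℤ (T : Set (Fin N → ℤ)) = ⊤
  separates : ∀ s' ∈ T, ∀ s : Fin N → ℤ, st.mulVec s = l • s' →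
    ∀ r₀ ∈ R, ∀ r' ∈ neigh L r₀ ∪ neigh L (-r₀), dotProduct s r = dotProduct s r' → r = r'

/-- `S = ⋃_{r ∈ R} { l st⁻¹ s' : s' ∈ T(r) }` for some positive `l` with `l ℤ^N ⊆ st ℤ^N`, some
system `R` of minimal representatives and some strong sets of restriction vectors `T(r)`. -/
def IsOldformTestSet {N : ℕ} (L st : Matrix (Fin N) (Fin N) ℤ) (S : Finset (Fin N → ℤ)) : Prop :=
  ∃ (l : ℤ) (R : Finset (Fin N → ℤ)) (T : (Fin N → ℤ) → Finset (Fin N → ℤ)),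
    0 < l ∧ (∀ v : Fin N → ℤ, ∃ w : Fin N → ℤ, st.mulVec w = l • v) ∧
    IsMinimalRepSystem L R ∧
    (∀ r ∈ R, IsStrongRestrictionSet L st l R r (T r)) ∧
    ∀ s : Fin N → ℤ, s ∈ S ↔ ∃ r ∈ R, ∃ s' ∈ T r, st.mulVec s = l • s'

/-- The numbers `l_s` are nonzero on the sets above. -/
theorem IsOldformTestSet.contentOf_ne_zero {N : ℕ} {L st : Matrix (Fin N) (Fin N) ℤ}
    {S : Finset (Fin N → ℤ)} (hS : IsOldformTestSet L st S) {s : Fin N → ℤ} (hs : s ∈ S) :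
    contentOf st s ≠ 0 := by
  obtain ⟨l, R, T, hl, -, -, hT, hmem⟩ := hS
  obtain ⟨r, hr, s', hs', h⟩ := (hmem s).1 hs
  intro h0
  apply (hT r hr).ne_zero s' hs'
  rw [contentOf, Finset.gcd_eq_zero_iff] at h0
  funext i
  have hi := h0 i (Finset.mem_univ i)
  rw [h] at hi
  simpa [hl.ne'] using hi

/-- The division in `scalarIndex` is exact. -/
theorem contentOf_sq_mul_scalarIndex {N : ℕ} (L' st : Matrix (Fin N) (Fin N) ℤ)
    (s : Fin N → ℤ) :
    contentOf st s ^ 2 * scalarIndex (gramPullback L' st) st s 0 0 =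
      gramPullback (gramPullback L' st) (colVec s) 0 0 := by
  have hdvd : contentOf st s ^ 2 ∣ gramPullback (gramPullback L' st) (colVec s) 0 0 := by
    have h1 : gramPullback (gramPullback L' st) (colVec s) 0 0 =
        ∑ j, (∑ i, st.mulVec s i * L' i j) * st.mulVec s j := by
      have h2 : gramPullback (gramPullback L' st) (colVec s) =
          (st * colVec s).transpose * L' * (st * colVec s) := by
        simp only [gramPullback, Matrix.transpose_mul, Matrix.mul_assoc]
      rw [h2]
      rfl
    rw [h1]
    refine Finset.dvd_sum fun j _ => ?_
    rw [pow_two]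
    refine mul_dvd_mul (Finset.dvd_sum fun i _ => ?_) (Finset.gcd_dvd (Finset.mem_univ j))
    exact Dvd.dvd.mul_right (Finset.gcd_dvd (Finset.mem_univ i)) _
  simpa [scalarIndex] using Int.mul_ediv_cancel' hdvd

end

/-! A form pulled back along `U_l` is invariant under translation by `1 / l`, so the hypothesis at
`s` says that `φ`, restricted to the line `ℂ s`, is invariant under translation by `s / l_s`. Write
`c(n, r)` for the Fourier coefficients of `φ`. If some `c(n, r)` with `r ∉ stᵗ ℤ^N` did not vanish,
take one with `n` least. Up to sign, `c(n, r)` depends only on the class of `r` in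
`(ℤ^N / L ℤ^N) / {±1}` and on `2 n - L⁻¹[r]`, and `L ℤ^N ⊆ stᵗ ℤ^N`; hence all `r ∉ stᵗ ℤ^N` with
`c(n, r) ≠ 0` have minimal norm in their classes, and some `r₀` in `R` is one of them. A test vector
`s` belonging to `r₀` separates `r₀` from the others, so on the line `ℂ s` the term of `c(n, r₀)` is
cancelled by no other, unless `l_s ∣ sᵗ r₀`; as `c(n, r₀) ≠ 0`, the periodicity forces this
divisibility. Since `s = l st⁻¹ s'` with `s'` running through a spanning set and `l ∣ l_s`, it puts
`r₀` into `stᵗ ℤ^N`, a contradiction.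

So `φ` is invariant under `st⁻¹ ℤ^N`, that is, `φ = ψ | U_st` with `ψ` invariant under `ℤ^N`.
Conjugating these translations by `S` yields the remaining elliptic transformations of index `L'`.

Test sets exist because a spanning set of `ℤ^N` can avoid finitely many given hyperplanes. -/

open MeasureTheory

theorem expTwoPiI_add (x y : ℂ) : expTwoPiI (x + y) = expTwoPiI x * expTwoPiI y := by
  simp only [expTwoPiI, mul_add, Complex.exp_add]

theorem expTwoPiI_zero : expTwoPiI 0 = 1 := by simp [expTwoPiI]

theorem expTwoPiI_intCast (n : ℤ) : expTwoPiI n = 1 :=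
  Complex.exp_eq_one_iff.2 ⟨n, by ring⟩

theorem expTwoPiI_add_intCast (x : ℂ) (n : ℤ) : expTwoPiI (x + n) = expTwoPiI x := by
  rw [expTwoPiI_add, expTwoPiI_intCast, mul_one]

theorem expTwoPiI_ne_zero (x : ℂ) : expTwoPiI x ≠ 0 := Complex.exp_ne_zero _

@[fun_prop]
theorem differentiable_expTwoPiI : Differentiable ℂ expTwoPiI := by
  unfold expTwoPiI
  fun_prop

@[fun_prop]
theorem continuous_expTwoPiI : Continuous expTwoPiI := differentiable_expTwoPiI.continuous

theorem norm_expTwoPiI (x : ℂ) : ‖expTwoPiI x‖ = Real.exp (-(2 * Real.pi * x.im)) := by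
  rw [expTwoPiI, Complex.norm_exp]
  simp

/-! ### Fourier analysis on a torus -/

section Torus

variable {ι : Type*}

/-- Functions on `ℂ^ι` that are periodic with respect to `ℤ^ι`. -/
def IntPeriodic (G : (ι → ℂ) → ℂ) : Prop :=
  ∀ (z : ι → ℂ) (m : ι → ℤ), G (z + fun i => (m i : ℂ)) = G z

namespace IntPeriodic

variable {G H : (ι → ℂ) → ℂ}

theorem mul (hG : IntPeriodic G) (hH : IntPeriodic H) : IntPeriodic fun z => G z * H z :=
  fun z m => congrArg₂ (· * ·) (hG z m) (hH z m)

theorem mul_const (hG : IntPeriodic G) (c : ℂ) : IntPeriodic fun z => G z * c :=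
  hG.mul fun _ _ => rfl

theorem comp_add_right (hG : IntPeriodic G) (w : ι → ℂ) : IntPeriodic fun z => G (z + w) :=
  fun z m => by simpa only [add_right_comm] using hG (z + w) m

end IntPeriodic

/-- The projection `ℝ^ι → (ℝ / ℤ)^ι`. -/
def torusMk (u : ι → ℝ) : UnitAddTorus ι := fun i => (u i : UnitAddCircle)

/-- A set-theoretic section of the projection `ℝ^ι → (ℝ / ℤ)^ι`, with values in `ℂ^ι`. It makes
the mean value of a periodic function an integral over the torus. -/
noncomputable def torusLift (x : UnitAddTorus ι) : ι → ℂ := fun i => ((x i).out : ℝ)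

theorem IntPeriodic.apply_torusLift {G : (ι → ℂ) → ℂ} (hG : IntPeriodic G) (u : ι → ℝ) :
    G (torusLift (torusMk u)) = G fun i => (u i : ℂ) := by
  have hint : ∀ i, ∃ m : ℤ, (m : ℝ) = (torusMk u i).out - u i := fun i => by
    have hout : (((torusMk u i).out : ℝ) : UnitAddCircle) = (u i : UnitAddCircle) :=
      QuotientAddGroup.out_eq' _
    obtain ⟨m, hm⟩ := (AddCircle.coe_eq_zero_iff 1).1
      ((AddCircle.coe_sub 1 _ _).trans (sub_eq_zero.2 hout))
    exact ⟨m, by simpa using hm⟩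
  choose m hm using hint
  rw [← hG (fun i => (u i : ℂ)) m]
  congr 1
  ext i
  rw [Pi.add_apply, ← Complex.ofReal_intCast, hm, torusLift]
  push_cast
  ring

theorem IntPeriodic.apply_torusLift_eq {G : (ι → ℂ) → ℂ} (hG : IntPeriodic G)
    {x : UnitAddTorus ι} {u : ι → ℝ} (h : x = torusMk u) :
    G (torusLift x) = G fun i => (u i : ℂ) := by
  rw [h, hG.apply_torusLift]

theorem torusMk_out (x : UnitAddTorus ι) : torusMk (fun i => ((x i).out : ℝ)) = x :=
  funext fun i => QuotientAddGroup.out_eq' (x i)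

theorem isOpenQuotientMap_torusMk : IsOpenQuotientMap (torusMk (ι := ι)) :=
  IsOpenQuotientMap.piMap fun _ => QuotientAddGroup.isOpenQuotientMap_mk

theorem continuous_comp_torusLift {A : Type*} [TopologicalSpace A] {F : A → (ι → ℂ) → ℂ}
    (hF : Continuous fun p : A × (ι → ℂ) => F p.1 p.2) (hper : ∀ a, IntPeriodic (F a)) :
    Continuous fun p : A × UnitAddTorus ι => F p.1 (torusLift p.2) := by
  rw [← (IsOpenQuotientMap.id.prodMap isOpenQuotientMap_torusMk).continuous_comp_iff]
  have hreal : Continuous fun p : A × (ι → ℝ) => F p.1 fun i => (p.2 i : ℂ) :=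
    hF.comp (g := fun p : A × (ι → ℂ) => F p.1 p.2)
      (f := fun p : A × (ι → ℝ) => (p.1, fun i => (p.2 i : ℂ))) (by fun_prop)
  exact hreal.congr fun p => ((hper p.1).apply_torusLift p.2).symm

variable [Fintype ι]

/-- The character `z ↦ e(∑ i, r i * z i)` of `ℂ^ι`. -/
noncomputable def expDot (r : ι → ℤ) (z : ι → ℂ) : ℂ := expTwoPiI (∑ i, (r i : ℂ) * z i)

theorem expDot_add_left (r s : ι → ℤ) (z : ι → ℂ) :
    expDot (r + s) z = expDot r z * expDot s z := by
  simp only [expDot, ← expTwoPiI_add, ← Finset.sum_add_distrib, ← add_mul, Pi.add_apply,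
    Int.cast_add]

theorem expDot_add_right (r : ι → ℤ) (z w : ι → ℂ) :
    expDot r (z + w) = expDot r z * expDot r w := by
  simp only [expDot, ← expTwoPiI_add, ← Finset.sum_add_distrib, ← mul_add, Pi.add_apply]

theorem expDot_zero_right (r : ι → ℤ) : expDot r 0 = 1 := by
  simp [expDot, expTwoPiI_zero]

theorem expDot_neg_left (r : ι → ℤ) (z : ι → ℂ) : expDot (-r) z = expDot r (-z) := by
  simp [expDot]

theorem expDot_smul_intCast (r m : ι → ℤ) (t : ℂ) :
    expDot r (t • fun i => (m i : ℂ)) = expTwoPiI (t * ((r ⬝ᵥ m : ℤ) : ℂ)) := by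
  simp only [expDot, dotProduct, Pi.smul_apply, smul_eq_mul, Int.cast_sum, Int.cast_mul,
    Finset.mul_sum]
  congr! 2
  ring

theorem expDot_mul_expDot_neg (r : ι → ℤ) (z : ι → ℂ) : expDot r z * expDot (-r) z = 1 := by
  rw [expDot_neg_left, ← expDot_add_right, add_neg_cancel, expDot_zero_right]

@[fun_prop]
theorem differentiable_expDot (r : ι → ℤ) : Differentiable ℂ (expDot r) := by
  unfold expDot
  fun_prop

@[fun_prop]
theorem continuous_expDot (r : ι → ℤ) : Continuous (expDot r) :=
  (differentiable_expDot r).continuous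

theorem intPeriodic_expDot (r : ι → ℤ) : IntPeriodic (expDot r) := fun z m => by
  rw [expDot_add_right, ← one_smul ℂ fun i => (m i : ℂ), expDot_smul_intCast, one_mul,
    expTwoPiI_intCast, mul_one]

variable (ι) in
/-- The probability Haar measure on the torus. -/
noncomputable def torusMeasure : Measure (UnitAddTorus ι) :=
  Measure.pi fun _ => AddCircle.haarAddCircle

instance : IsProbabilityMeasure (torusMeasure ι) := by
  unfold torusMeasure
  infer_instance

instance : (torusMeasure ι).IsAddHaarMeasure := by
  unfold torusMeasure
  infer_instance

instance : (torusMeasure ι).IsNegInvariant :=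
  have : (AddCircle.haarAddCircle (T := 1)).IsNegInvariant := inferInstance
  Measure.pi.isNegInvariant _

/-- The mean value over `(ℝ / ℤ)^ι` of a `ℤ^ι`-periodic function; only the values at real points
matter. -/
noncomputable def torusMean (G : (ι → ℂ) → ℂ) : ℂ := ∫ x, G (torusLift x) ∂torusMeasure ι

theorem torusMean_const_mul (c : ℂ) (G : (ι → ℂ) → ℂ) :
    torusMean (fun z => c * G z) = c * torusMean G :=
  integral_const_mul _ _

theorem torusMean_comp_add_ofReal {G : (ι → ℂ) → ℂ} (hG : IntPeriodic G) (a : ι → ℝ) :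
    torusMean (fun z => G (z + fun i => (a i : ℂ))) = torusMean G := by
  unfold torusMean
  rw [← integral_add_right_eq_self (fun x => G (torusLift x)) (torusMk a)]
  congr with x
  have hx : x + torusMk a = torusMk ((fun i => (x i).out) + a) := by
    nth_rw 1 [← torusMk_out x]
    rfl
  rw [hG.apply_torusLift_eq hx]
  simp [torusLift, Pi.add_def]

theorem torusMean_comp_neg {G : (ι → ℂ) → ℂ} (hG : IntPeriodic G) :
    torusMean (fun z => G (-z)) = torusMean G := by
  unfold torusMean
  rw [← integral_neg_eq_self (fun x => G (torusLift x))]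
  congr with x
  have hx : -x = torusMk (-fun i => (x i).out) := by
    nth_rw 1 [← torusMk_out x]
    rfl
  rw [hG.apply_torusLift_eq hx]
  simp [torusLift, Pi.neg_def]

theorem intervalIntegral_torusMean {F : ℝ → (ι → ℂ) → ℂ}
    (hF : Continuous fun p : ℝ × (ι → ℂ) => F p.1 p.2) (hper : ∀ a, IntPeriodic (F a)) :
    ∫ x in (0 : ℝ)..1, torusMean (F x) = torusMean fun z => ∫ x in (0 : ℝ)..1, F x z := by
  refine intervalIntegral_integral_swap ?_
  rw [Set.uIoc_of_le zero_le_one]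
  have hint : IntegrableOn (fun p : ℝ × UnitAddTorus ι => F p.1 (torusLift p.2))
      (Set.Icc (0 : ℝ) 1 ×ˢ Set.univ) (volume.prod (torusMeasure ι)) :=
    (continuous_comp_torusLift hF hper).continuousOn.integrableOn_compact
      (isCompact_Icc.prod isCompact_univ)
  rw [IntegrableOn, ← Measure.prod_restrict, Measure.restrict_univ] at hint
  exact hint.mono_measure
    (Measure.prod_mono (Measure.restrict_mono Set.Ioc_subset_Icc_self le_rfl) le_rfl)

theorem mFourier_torusMk (r : ι → ℤ) (u : ι → ℝ) :
    UnitAddTorus.mFourier r (torusMk u) = expDot r fun i => (u i : ℂ) := by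
  simp only [UnitAddTorus.mFourier, ContinuousMap.coe_mk, torusMk, fourier_coe_apply]
  rw [← Complex.exp_sum, expDot, expTwoPiI, Finset.mul_sum]
  congr! 2
  push_cast
  ring

theorem IntPeriodic.apply_zero_eq_sum {G : (ι → ℂ) → ℂ} (hG : Continuous G)
    (hper : IntPeriodic G) (B : Finset (ι → ℤ))
    (hB : ∀ r ∉ B, torusMean (fun z => G z * expDot (-r) z) = 0) :
    G 0 = ∑ r ∈ B, torusMean fun z => G z * expDot (-r) z := by
  have hcont : Continuous fun x : UnitAddTorus ι => G (torusLift x) :=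
    (continuous_comp_torusLift (A := Unit) (F := fun _ => G) (by fun_prop) fun _ => hper).comp
      (f := fun x => ((), x)) (by fun_prop)
  let F : C(UnitAddTorus ι, ℂ) := ⟨_, hcont⟩
  have hcoeff (r : ι → ℤ) :
      UnitAddTorus.mFourierCoeff F r = torusMean fun z => G z * expDot (-r) z := by
    change ∫ x, UnitAddTorus.mFourier (-r) x • G (torusLift x) ∂torusMeasure ι = _
    rw [torusMean]
    congr with x
    rw [smul_eq_mul, mul_comm]
    nth_rw 2 [← torusMk_out x]
    rw [mFourier_torusMk]
    rfl
  have hsum := UnitAddTorus.hasSum_mFourier_series_apply_of_summable (f := F)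
    (summable_of_hasFiniteSupport (B.finite_toSet.subset fun r hr => by
      by_contra h
      exact hr ((hcoeff r).trans (hB r h)))) (torusMk 0)
  have hsum' := hsum.unique (hasSum_sum_of_ne_finset_zero (s := B) fun r hr => by
    rw [hcoeff, hB r hr, zero_smul])
  have hzero : (fun _ : ι => ((0 : ℝ) : ℂ)) = 0 := by simp [Pi.zero_def]
  have hF0 : F (torusMk 0) = G 0 := by
    rw [← hzero]
    exact hper.apply_torusLift 0
  rw [← hF0, hsum']
  refine Finset.sum_congr rfl fun r _ => ?_
  rw [hcoeff, mFourier_torusMk, smul_eq_mul, Pi.zero_def, hzero, expDot_zero_right, mul_one]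

end Torus

theorem eq_zero_of_fourier_integrals_eq_zero {f : ℝ → ℂ} (hf : Continuous f)
    (hper : Function.Periodic f 1)
    (h : ∀ n : ℤ, ∫ x in (0 : ℝ)..1, f x * expTwoPiI (-n * x) = 0) : f = 0 := by
  let F : C(UnitAddCircle, ℂ) := ⟨hper.lift, (QuotientAddGroup.isOpenQuotientMap_mk
    (N := AddSubgroup.zmultiples (1 : ℝ))).continuous_comp_iff.1 hf⟩
  have hF (x : ℝ) : F x = f x := hper.lift_coe x
  have hcoeff (n : ℤ) : fourierCoeff F n = 0 := by
    rw [fourierCoeff_eq_intervalIntegral F n 0, zero_add, one_div, inv_one, one_smul, ← h n]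
    congr with x
    rw [hF, fourier_coe_apply, smul_eq_mul, mul_comm, expTwoPiI]
    congr 2
    push_cast
    ring
  funext x
  have hsum := has_pointwise_sum_fourier_series_of_summable (f := F)
    (by simp [funext hcoeff]) (x : UnitAddCircle)
  simp only [hcoeff, zero_smul] at hsum
  exact (hF x).symm.trans (hsum.unique hasSum_zero)

/-! ### Shifting contours -/

theorem intervalIntegral_horizontal_eq {f : ℂ → ℂ} {y₁ y₂ : ℝ}
    (hf : DifferentiableOn ℂ f (Complex.im ⁻¹' Set.uIcc y₁ y₂))
    (hper : ∀ z : ℂ, z.im ∈ Set.uIcc y₁ y₂ → f (z + 1) = f z) :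
    ∫ x in (0 : ℝ)..1, f (x + y₁ * Complex.I) = ∫ x in (0 : ℝ)..1, f (x + y₂ * Complex.I) := by
  have hrect := Complex.integral_boundary_rect_eq_zero_of_differentiableOn f (y₁ * Complex.I)
    (1 + y₂ * Complex.I) (hf.mono fun z hz => by simpa using (Complex.mem_reProdIm.1 hz).2)
  have hvertical : ∫ y in y₁..y₂, f (1 + y * Complex.I) = ∫ y in y₁..y₂, f (y * Complex.I) :=
    intervalIntegral.integral_congr fun y hy => by
      rw [add_comm]
      exact hper _ (by simpa using hy)
  simp only [Complex.mul_re, Complex.ofReal_re, Complex.I_re, mul_zero, Complex.ofReal_im,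
    Complex.I_im, mul_one, sub_self, Complex.add_re, Complex.one_re, add_zero, Complex.mul_im,
    Complex.add_im, Complex.one_im, zero_add, Complex.ofReal_one, Complex.ofReal_zero,
    hvertical] at hrect
  rw [add_sub_cancel_right] at hrect
  exact sub_eq_zero.1 hrect

section ContourShift

variable {ι : Type*} [Fintype ι] {G : (ι → ℂ) → ℂ}

theorem torusMean_eq_torusMean_intervalIntegral (hG : Continuous G) (hper : IntPeriodic G)
    (a : ι → ℝ) : torusMean G =
      torusMean fun z => ∫ x in (0 : ℝ)..1, G (z + (x : ℂ) • fun i => (a i : ℂ)) := by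
  rw [← intervalIntegral_torusMean (by fun_prop) fun _ => hper.comp_add_right _]
  have hconst (x : ℝ) : torusMean (fun z => G (z + (x : ℂ) • fun i => (a i : ℂ))) =
      torusMean G := by
    simpa [Pi.smul_def] using torusMean_comp_add_ofReal hper (x • a)
  simp only [hconst, intervalIntegral.integral_const, sub_zero, one_smul]

theorem torusMean_comp_add_smul_I (hG : Differentiable ℂ G) (hper : IntPeriodic G)
    (y : ℝ) (m : ι → ℤ) :
    torusMean (fun z => G (z + ((y : ℂ) * Complex.I) • fun i => (m i : ℂ))) = torusMean G := by
  rw [torusMean_eq_torusMean_intervalIntegral hG.continuous hper fun i => (m i : ℝ),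
    torusMean_eq_torusMean_intervalIntegral (G := fun z => G (z + _))
      (hG.continuous.comp (by fun_prop)) (hper.comp_add_right _) fun i => (m i : ℝ)]
  simp only [Complex.ofReal_intCast]
  congr with z
  have hshift := intervalIntegral_horizontal_eq (y₁ := y) (y₂ := 0)
    (f := fun s => G (z + s • fun i => (m i : ℂ))) (by fun_prop) fun s _ => by
      rw [add_smul, one_smul, ← add_assoc, hper]
  simpa [add_smul, add_assoc] using hshift

theorem torusMean_comp_add (hG : Differentiable ℂ G) (hper : IntPeriodic G) (w : ι → ℂ) :
    torusMean (fun z => G (z + w)) = torusMean G := by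
  classical
  have himag (s : Finset ι) :
      torusMean (fun z => G (z + ∑ j ∈ s, ((w j).im * Complex.I) •
        fun i => ((Pi.single j 1 : ι → ℤ) i : ℂ))) = torusMean G := by
    induction s using Finset.induction_on with
    | empty => simp
    | insert j s hj ih =>
      rw [← ih, ← torusMean_comp_add_smul_I (G := fun z => G (z + ∑ j ∈ s, _)) (by fun_prop)
        (hper.comp_add_right _) (w j).im (Pi.single j 1)]
      simp only [Finset.sum_insert hj, add_assoc]
  have hreal := torusMean_comp_add_ofReal (hper.comp_add_right
    (∑ j, ((w j).im * Complex.I) • fun i => ((Pi.single j 1 : ι → ℤ) i : ℂ))) fun i => (w i).re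
  rw [← himag Finset.univ, ← hreal]
  congr with z
  congr 1
  ext i
  simp [Pi.single_apply, add_assoc]

theorem torusMean_comp_add_mul_expDot (hG : Differentiable ℂ G) (hper : IntPeriodic G)
    (r : ι → ℤ) (w : ι → ℂ) :
    torusMean (fun z => G (z + w) * expDot r z) =
      expDot (-r) w * torusMean fun z => G z * expDot r z := by
  rw [← torusMean_comp_add (G := fun z => G z * expDot r z) (by fun_prop)
    (hper.mul (intPeriodic_expDot r)) w, ← torusMean_const_mul]
  congr with z
  linear_combination (-G (z + w) * expDot r z) * expDot_mul_expDot_neg r w -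
    G (z + w) * expDot (-r) w * expDot_add_right r z w

end ContourShift

/-! ### Fourier coefficients of forms for the parabolic subgroup -/

/-- The properties of a Jacobi form of weight `k` and index `L`, read as a function of `t ∈ ℂ` and
`z ∈ ℂ^ι`, that express its invariance under the parabolic part of the Jacobi group and its growth
at the cusp. Only the values at `t` in the upper half plane matter. -/
structure IsParabolicForm {ι : Type*} [Fintype ι] (k : ℤ) (L : Matrix ι ι ℤ)
    (Φ : ℂ → (ι → ℂ) → ℂ) : Prop where
  holo : DifferentiableOn ℂ (fun p : ℂ × (ι → ℂ) => Φ p.1 p.2) {p | 0 < p.1.im}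
  add_one : ∀ t, 0 < t.im → Φ (t + 1) = Φ t
  intPeriodic : ∀ t, 0 < t.im → IntPeriodic (Φ t)
  elliptic : ∀ t, 0 < t.im → ∀ (z : ι → ℂ) (lam : ι → ℤ),
    expTwoPiI (t * ((lam ⬝ᵥ L.mulVec lam : ℤ) : ℂ) / 2) * expDot (L.mulVec lam) z *
      Φ t (z + t • fun i => (lam i : ℂ)) = Φ t z
  neg : ∀ t, 0 < t.im → ∀ z, Φ t (-z) = (-1) ^ k * Φ t z
  bounded : ∀ β : ι → ℚ, ∃ C A : ℝ, ∀ t : ℂ, A ≤ t.im → 0 < t.im → ‖Φ t fun i => (β i : ℂ)‖ ≤ C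

section FourierCoeff

variable {ι : Type*}

/-- The `n`-th Fourier coefficient of `Φ` in its first variable, a function of the second one. It
is computed at height `1`, but does not depend on the height. -/
noncomputable def fourierJacobiCoeff (Φ : ℂ → (ι → ℂ) → ℂ) (n : ℤ) (z : ι → ℂ) : ℂ :=
  ∫ x in (0 : ℝ)..1, Φ (x + Complex.I) z * expTwoPiI (-n * (x + Complex.I))

/-- The Fourier coefficient `c(n, r)` of `Φ`. -/
noncomputable def jacobiFourierCoeff [Fintype ι] (Φ : ℂ → (ι → ℂ) → ℂ) (n : ℤ) (r : ι → ℤ) : ℂ :=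
  torusMean fun z => fourierJacobiCoeff Φ n z * expDot (-r) z

end FourierCoeff

namespace IsParabolicForm

variable {ι : Type*} [Fintype ι] {k : ℤ} {L : Matrix ι ι ℤ} {Φ : ℂ → (ι → ℂ) → ℂ}

theorem continuous_comp (h : IsParabolicForm k L Φ) {A : Type*} [TopologicalSpace A]
    {f : A → ℂ} {g : A → ι → ℂ} (hf : Continuous f) (hg : Continuous g)
    (hpos : ∀ a, 0 < (f a).im) : Continuous fun a => Φ (f a) (g a) :=
  h.holo.continuousOn.comp_continuous (hf.prodMk hg) hpos

theorem continuous_comp_add_I (h : IsParabolicForm k L Φ) {A : Type*} [TopologicalSpace A]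
    {f : A → ℝ} {g : A → ι → ℂ} (hf : Continuous f) (hg : Continuous g) :
    Continuous fun a => Φ (f a + Complex.I) (g a) :=
  h.continuous_comp (by fun_prop) hg (by simp)

theorem differentiable_right (h : IsParabolicForm k L Φ) {t : ℂ} (ht : 0 < t.im) :
    Differentiable ℂ (Φ t) := fun z => by
  have hopen : IsOpen {p : ℂ × (ι → ℂ) | 0 < p.1.im} :=
    isOpen_lt continuous_const (Complex.continuous_im.comp continuous_fst)
  exact DifferentiableAt.comp (f := fun z => (t, z)) z
    ((h.holo (t, z) ht).differentiableAt (hopen.mem_nhds ht)) (by fun_prop)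

theorem differentiableOn_left (h : IsParabolicForm k L Φ) (z : ι → ℂ) :
    DifferentiableOn ℂ (fun t => Φ t z) {t | 0 < t.im} :=
  DifferentiableOn.comp (f := fun t => (t, z)) h.holo (by fun_prop) fun _ ht => ht

theorem continuous_fourierJacobiCoeff (h : IsParabolicForm k L Φ) (n : ℤ) :
    Continuous (fourierJacobiCoeff Φ n) := by
  unfold fourierJacobiCoeff
  refine intervalIntegral.continuous_parametric_intervalIntegral_of_continuous' ?_ _ _
  exact (h.continuous_comp_add_I continuous_snd continuous_fst).mul (by fun_prop)

theorem intPeriodic_fourierJacobiCoeff (h : IsParabolicForm k L Φ) (n : ℤ) :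
    IntPeriodic (fourierJacobiCoeff Φ n) := fun z m => by
  unfold fourierJacobiCoeff
  congr with x
  rw [h.intPeriodic _ (by simp)]

theorem fourierJacobiCoeff_eq_intervalIntegral (h : IsParabolicForm k L Φ) {y : ℝ} (hy : 0 < y)
    (n : ℤ) (z : ι → ℂ) : fourierJacobiCoeff Φ n z =
      ∫ x in (0 : ℝ)..1, Φ (x + y * Complex.I) z * expTwoPiI (-n * (x + y * Complex.I)) := by
  have hpos : ∀ η ∈ Set.uIcc 1 y, 0 < η := fun η hη => (lt_min one_pos hy).trans_le hη.1
  have hheight := intervalIntegral_horizontal_eq (y₁ := 1) (y₂ := y)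
    (f := fun t => Φ t z * expTwoPiI (-n * t))
    (((h.differentiableOn_left z).mono fun t ht => hpos _ ht).mul (by fun_prop)) fun t ht => by
      rw [h.add_one _ (hpos _ ht), mul_add, mul_one, ← Int.cast_neg, expTwoPiI_add_intCast]
  simpa only [fourierJacobiCoeff, Complex.ofReal_one, one_mul] using hheight

theorem fourierJacobiCoeff_neg (h : IsParabolicForm k L Φ) (n : ℤ) (z : ι → ℂ) :
    fourierJacobiCoeff Φ n (-z) = (-1) ^ k * fourierJacobiCoeff Φ n z := by
  unfold fourierJacobiCoeff
  rw [← intervalIntegral.integral_const_mul]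
  congr with x
  rw [h.neg _ (by simp), mul_assoc]

/-! ### Vanishing of the coefficients with `n < 0` -/

theorem norm_fourierJacobiCoeff_le (h : IsParabolicForm k L Φ) {y : ℝ} (hy : 0 < y) {C : ℝ}
    {z : ι → ℂ} (hC : ∀ t : ℂ, t.im = y → ‖Φ t z‖ ≤ C) (n : ℤ) :
    ‖fourierJacobiCoeff Φ n z‖ ≤ C * Real.exp (2 * Real.pi * n * y) := by
  rw [h.fourierJacobiCoeff_eq_intervalIntegral hy]
  refine (intervalIntegral.norm_integral_le_of_norm_le_const fun x _ => ?_).trans_eq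
    (by rw [sub_zero, abs_one, mul_one])
  have him : (-(n : ℂ) * (x + y * Complex.I)).im = -(n * y) := by simp
  rw [norm_mul, norm_expTwoPiI, him, mul_neg, neg_neg, ← mul_assoc]
  exact mul_le_mul_of_nonneg_right (hC _ (by simp)) (Real.exp_pos _).le

theorem fourierJacobiCoeff_ratCast_eq_zero (h : IsParabolicForm k L Φ) {n : ℤ} (hn : n < 0)
    (β : ι → ℚ) : fourierJacobiCoeff Φ n (fun i => (β i : ℂ)) = 0 := by
  obtain ⟨C, A, hC⟩ := h.bounded β
  have hbound : ∀ᶠ y : ℝ in Filter.atTop, ‖fourierJacobiCoeff Φ n fun i => (β i : ℂ)‖ ≤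
      C * Real.exp (2 * Real.pi * n * y) := by
    filter_upwards [Filter.eventually_ge_atTop A, Filter.eventually_gt_atTop 0] with y hA hy
    exact h.norm_fourierJacobiCoeff_le hy (fun t ht => hC t (ht ▸ hA) (ht ▸ hy)) n
  have hdecay : Filter.Tendsto (fun y : ℝ => C * Real.exp (2 * Real.pi * n * y)) Filter.atTop
      (nhds (C * 0)) := by
    refine (Real.tendsto_exp_atBot.comp ?_).const_mul C
    exact Filter.tendsto_id.const_mul_atTop_of_neg
      (mul_neg_of_pos_of_neg Real.two_pi_pos (Int.cast_lt_zero.2 hn))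
  rw [mul_zero] at hdecay
  exact norm_le_zero_iff.1 (ge_of_tendsto hdecay hbound)

theorem fourierJacobiCoeff_ofReal_eq_zero (h : IsParabolicForm k L Φ) {n : ℤ} (hn : n < 0)
    (u : ι → ℝ) : fourierJacobiCoeff Φ n (fun i => (u i : ℂ)) = 0 := by
  have hdense : DenseRange fun (β : ι → ℚ) (i : ι) => (β i : ℝ) :=
    DenseRange.piMap fun _ => Rat.denseRange_cast
  have hcont : Continuous fun u : ι → ℝ => fourierJacobiCoeff Φ n fun i => (u i : ℂ) :=
    (h.continuous_fourierJacobiCoeff n).comp (by fun_prop)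
  refine congrFun (hdense.equalizer hcont continuous_const (funext fun β => ?_)) u
  simpa using h.fourierJacobiCoeff_ratCast_eq_zero hn β

theorem jacobiFourierCoeff_eq_zero_of_neg (h : IsParabolicForm k L Φ) {n : ℤ} (hn : n < 0)
    (r : ι → ℤ) : jacobiFourierCoeff Φ n r = 0 := by
  have hzero (x : UnitAddTorus ι) : fourierJacobiCoeff Φ n (torusLift x) = 0 :=
    h.fourierJacobiCoeff_ofReal_eq_zero hn _
  simp [jacobiFourierCoeff, torusMean, hzero]

/-! ### Symmetries of the coefficients and the Fourier expansion -/

theorem torusMean_fourierJacobiCoeff (h : IsParabolicForm k L Φ) (n : ℤ) (r : ι → ℤ)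
    (w : ι → ℂ) : torusMean (fun z => fourierJacobiCoeff Φ n (z + w) * expDot r z) =
      ∫ x in (0 : ℝ)..1, expTwoPiI (-n * (x + Complex.I)) *
        torusMean fun z => Φ (x + Complex.I) (z + w) * expDot r z := by
  have hcomm (x : ℝ) (z : ι → ℂ) :
      expTwoPiI (-n * (x + Complex.I)) * (Φ (x + Complex.I) (z + w) * expDot r z) =
        Φ (x + Complex.I) (z + w) * expTwoPiI (-n * (x + Complex.I)) * expDot r z := by
    ring
  simp only [← torusMean_const_mul, hcomm]
  rw [intervalIntegral_torusMean]
  · simp only [intervalIntegral.integral_mul_const]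
    rfl
  · exact ((h.continuous_comp_add_I continuous_fst (continuous_snd.add continuous_const)).mul
      (by fun_prop)).mul (by fun_prop)
  · exact fun x => (((h.intPeriodic _ (by simp)).comp_add_right w).mul_const _).mul
      (intPeriodic_expDot r)

theorem jacobiFourierCoeff_eq_intervalIntegral (h : IsParabolicForm k L Φ) (n : ℤ) (r : ι → ℤ) :
    jacobiFourierCoeff Φ n r = ∫ x in (0 : ℝ)..1, expTwoPiI (-n * (x + Complex.I)) *
      torusMean fun z => Φ (x + Complex.I) z * expDot (-r) z := by
  simpa only [jacobiFourierCoeff, add_zero] using h.torusMean_fourierJacobiCoeff n (-r) 0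

theorem torusMean_fourierJacobiCoeff_comp_add (h : IsParabolicForm k L Φ) (n : ℤ) (r : ι → ℤ)
    (w : ι → ℂ) : torusMean (fun z => fourierJacobiCoeff Φ n (z + w) * expDot (-r) z) =
      expDot r w * jacobiFourierCoeff Φ n r := by
  rw [h.torusMean_fourierJacobiCoeff, h.jacobiFourierCoeff_eq_intervalIntegral,
    ← intervalIntegral.integral_const_mul]
  congr with x
  rw [torusMean_comp_add_mul_expDot (h.differentiable_right (by simp)) (h.intPeriodic _ (by simp)),
    neg_neg, mul_left_comm]

theorem fourierJacobiCoeff_eq_sum (h : IsParabolicForm k L Φ) {n : ℤ} {B : Finset (ι → ℤ)}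
    (hB : ∀ r ∉ B, jacobiFourierCoeff Φ n r = 0) (z : ι → ℂ) :
    fourierJacobiCoeff Φ n z = ∑ r ∈ B, jacobiFourierCoeff Φ n r * expDot r z := by
  have hsum := ((h.intPeriodic_fourierJacobiCoeff n).comp_add_right z).apply_zero_eq_sum
    ((h.continuous_fourierJacobiCoeff n).comp (continuous_add_const z)) B fun r hr => by
      simp only [Function.comp_apply]
      rw [h.torusMean_fourierJacobiCoeff_comp_add, hB r hr, mul_zero]
  simpa only [Function.comp_apply, zero_add, h.torusMean_fourierJacobiCoeff_comp_add,
    mul_comm] using hsum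

theorem jacobiFourierCoeff_add_mulVec (h : IsParabolicForm k L Φ) {n E : ℤ} {r lam : ι → ℤ}
    (hE : 2 * E = 2 * (r ⬝ᵥ lam) + lam ⬝ᵥ L.mulVec lam) :
    jacobiFourierCoeff Φ (n + E) (r + L.mulVec lam) = jacobiFourierCoeff Φ n r := by
  rw [h.jacobiFourierCoeff_eq_intervalIntegral, h.jacobiFourierCoeff_eq_intervalIntegral]
  congr with x
  set t : ℂ := x + Complex.I with ht
  have htpos : 0 < t.im := by simp [ht]
  have hell (z : ι → ℂ) : Φ t z * expDot (-(r + L.mulVec lam)) z =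
      expTwoPiI (t * ((lam ⬝ᵥ L.mulVec lam : ℤ) : ℂ) / 2) *
        (Φ t (z + t • fun i => (lam i : ℂ)) * expDot (-r) z) := by
    rw [← h.elliptic t htpos z lam, neg_add, expDot_add_left]
    linear_combination expTwoPiI (t * ((lam ⬝ᵥ L.mulVec lam : ℤ) : ℂ) / 2) *
      Φ t (z + t • fun i => (lam i : ℂ)) * expDot (-r) z *
        expDot_mul_expDot_neg (L.mulVec lam) z
  simp only [hell, torusMean_const_mul]
  rw [torusMean_comp_add_mul_expDot (h.differentiable_right htpos) (h.intPeriodic t htpos),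
    neg_neg, expDot_smul_intCast, ← mul_assoc, ← mul_assoc, ← expTwoPiI_add, ← expTwoPiI_add]
  congr 2
  have hE' : (2 : ℂ) * E = 2 * ((r ⬝ᵥ lam : ℤ) : ℂ) + ((lam ⬝ᵥ L.mulVec lam : ℤ) : ℂ) := by
    exact_mod_cast hE
  push_cast
  linear_combination (-t / 2) * hE'

theorem jacobiFourierCoeff_neg (h : IsParabolicForm k L Φ) (n : ℤ) (r : ι → ℤ) :
    jacobiFourierCoeff Φ n (-r) = (-1) ^ k * jacobiFourierCoeff Φ n r := by
  have hper := (h.intPeriodic_fourierJacobiCoeff n).mul (intPeriodic_expDot (- -r))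
  rw [jacobiFourierCoeff, ← torusMean_comp_neg hper, jacobiFourierCoeff, ← torusMean_const_mul]
  congr with z
  rw [h.fourierJacobiCoeff_neg, expDot_neg_left (-r), neg_neg, mul_assoc]

theorem comp_add_eq_of_fourierJacobiCoeff (h : IsParabolicForm k L Φ) {w : ι → ℂ}
    (hw : ∀ n z, fourierJacobiCoeff Φ n (z + w) = fourierJacobiCoeff Φ n z)
    {t : ℂ} (ht : 0 < t.im) (z : ι → ℂ) : Φ t (z + w) = Φ t z := by
  have hpos (x : ℝ) : 0 < ((x : ℂ) + t.im * Complex.I).im := by simpa using ht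
  have hcont (z : ι → ℂ) : Continuous fun x : ℝ => Φ (x + t.im * Complex.I) z :=
    h.continuous_comp (by fun_prop) continuous_const hpos
  have hcoeff (n : ℤ) : ∫ x in (0 : ℝ)..1, (Φ (x + t.im * Complex.I) (z + w) -
      Φ (x + t.im * Complex.I) z) * expTwoPiI (-n * x) = 0 := by
    have hint (z : ι → ℂ) : IntervalIntegrable
        (fun x : ℝ => Φ (x + t.im * Complex.I) z * expTwoPiI (-n * (x + t.im * Complex.I)))
        volume 0 1 := ((hcont z).mul (by fun_prop)).intervalIntegrable _ _
    have hn := sub_eq_zero.2 (hw n z)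
    rw [h.fourierJacobiCoeff_eq_intervalIntegral ht, h.fourierJacobiCoeff_eq_intervalIntegral ht,
      ← intervalIntegral.integral_sub (hint _) (hint _)] at hn
    simp only [mul_add, expTwoPiI_add, ← sub_mul, ← mul_assoc] at hn
    rw [intervalIntegral.integral_mul_const] at hn
    exact (mul_eq_zero.1 hn).resolve_right (expTwoPiI_ne_zero _)
  have hzero := congrFun (eq_zero_of_fourier_integrals_eq_zero ((hcont _).sub (hcont _))
    (fun x => by
      simp only [Pi.sub_apply, Complex.ofReal_add, Complex.ofReal_one, add_right_comm _ (1 : ℂ),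
        h.add_one _ (hpos x)]) hcoeff) t.re
  simpa only [Pi.sub_apply, Complex.re_add_im, Pi.zero_apply, sub_eq_zero] using hzero

end IsParabolicForm

/-! ### Minimal representatives of the discriminant module -/

theorem intCast_dotProduct {ι R : Type*} [Fintype ι] [Ring R] (v w : ι → ℤ) :
    ((v ⬝ᵥ w : ℤ) : R) = (fun i => (v i : R)) ⬝ᵥ fun i => (w i : R) :=
  RingHom.map_dotProduct (Int.castRingHom R) v w

theorem intCast_mulVec {ι κ R : Type*} [Fintype κ] [Ring R] (M : Matrix ι κ ℤ) (v : κ → ℤ) :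
    (fun i => (M.mulVec v i : R)) = (M.map (Int.cast : ℤ → R)).mulVec fun j => (v j : R) :=
  funext fun i => RingHom.map_mulVec (Int.castRingHom R) M v i

namespace IsJacobiIndex

variable {N : ℕ} {L : Matrix (Fin N) (Fin N) ℤ}

theorem posDef_ratCast (hL : IsJacobiIndex L) : (L.map (Int.cast : ℤ → ℚ)).PosDef := by
  refine .of_dotProduct_mulVec_pos (by ext i j; simp [hL.symm.apply i j]) fun w hw => ?_
  have hw' : (fun i => (w i : ℝ)) ≠ 0 := fun h =>
    hw (funext fun i => by simpa using congrFun h i)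
  have h := hL.posDef.dotProduct_mulVec_pos hw'
  simp only [dotProduct, Matrix.mulVec, Matrix.map_apply, star_trivial] at h ⊢
  exact_mod_cast h

theorem isUnit_det_ratCast (hL : IsJacobiIndex L) : IsUnit (L.map (Int.cast : ℤ → ℚ)).det :=
  (Matrix.isUnit_iff_isUnit_det _).1 hL.posDef_ratCast.isUnit

theorem det_ne_zero (hL : IsJacobiIndex L) : L.det ≠ 0 := fun h0 => by
  refine hL.isUnit_det_ratCast.ne_zero (((Int.castRingHom ℚ).map_det L).symm.trans ?_)
  rw [h0, map_zero]

theorem inv_mulVec_intCast_mulVec (hL : IsJacobiIndex L) (lam : Fin N → ℤ) :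
    (L.map (Int.cast : ℤ → ℚ))⁻¹.mulVec (fun i => (L.mulVec lam i : ℚ)) = fun i => (lam i : ℚ) := by
  rw [intCast_mulVec, Matrix.mulVec_mulVec, Matrix.nonsing_inv_mul _ hL.isUnit_det_ratCast,
    Matrix.one_mulVec]

theorem intCast_mulVec_dotProduct_inv_mulVec (hL : IsJacobiIndex L) (x : Fin N → ℚ)
    (lam : Fin N → ℤ) :
    (fun i => (L.mulVec lam i : ℚ)) ⬝ᵥ (L.map (Int.cast : ℤ → ℚ))⁻¹.mulVec x =
      x ⬝ᵥ fun i => (lam i : ℚ) := by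
  rw [Matrix.dotProduct_mulVec, ← Matrix.mulVec_transpose, Matrix.transpose_nonsing_inv,
    (Matrix.isHermitian_iff_isSymm.1 hL.posDef_ratCast.isHermitian).eq,
    hL.inv_mulVec_intCast_mulVec, dotProduct_comm]

theorem dualNorm_add_mulVec (hL : IsJacobiIndex L) (r lam : Fin N → ℤ) :
    dualNorm L (r + L.mulVec lam) =
      dualNorm L r + ((2 * (r ⬝ᵥ lam) + lam ⬝ᵥ L.mulVec lam : ℤ) : ℚ) := by
  have hcast : (fun i => ((r + L.mulVec lam) i : ℚ)) =
      (fun i => (r i : ℚ)) + fun i => (L.mulVec lam i : ℚ) := by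
    ext i
    simp
  rw [dualNorm, dualNorm, hcast, Matrix.mulVec_add, hL.inv_mulVec_intCast_mulVec, add_dotProduct,
    dotProduct_add, dotProduct_add, hL.intCast_mulVec_dotProduct_inv_mulVec,
    ← intCast_dotProduct, ← intCast_dotProduct, dotProduct_comm (L.mulVec lam)]
  push_cast
  ring

theorem dualNorm_nonneg (hL : IsJacobiIndex L) (r : Fin N → ℤ) : 0 ≤ dualNorm L r :=
  hL.posDef_ratCast.inv.posSemidef.dotProduct_mulVec_nonneg _

theorem sq_le_dualNorm (hL : IsJacobiIndex L) (r : Fin N → ℤ) (i : Fin N) :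
    (r i : ℚ) ^ 2 ≤ dualNorm L r * L i i := by
  have hA := hL.posDef_ratCast.inv
  have hentry : (fun j => (L.mulVec (Pi.single i 1) j : ℚ)) i = L i i := by simp
  have hsingle : (fun j => ((Pi.single i 1 : Fin N → ℤ) j : ℚ)) = Pi.single i 1 := by
    ext j
    simp [Pi.single_apply]
  have hCS := LinearMap.BilinForm.apply_sq_le_of_symm
    (Matrix.toBilin' (L.map (Int.cast : ℤ → ℚ))⁻¹) (fun x => by
      simpa only [Matrix.toBilin'_apply', star_trivial] using
        hA.posSemidef.dotProduct_mulVec_nonneg x)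
    ⟨(Matrix.isSymm_toBilin'_iff_isSymm.2 (Matrix.isHermitian_iff_isSymm.1 hA.isHermitian)).eq⟩
    (fun j => (r j : ℚ)) fun j => (L.mulVec (Pi.single i 1) j : ℚ)
  simpa only [Matrix.toBilin'_apply', hL.inv_mulVec_intCast_mulVec, hsingle,
    dotProduct_single_one, hentry, dualNorm] using hCS

theorem finite_setOf_dualNorm_le (hL : IsJacobiIndex L) (C : ℚ) :
    {r : Fin N → ℤ | dualNorm L r ≤ C}.Finite := by
  let b : Fin N → ℤ := fun i => ⌈C * |(L i i : ℚ)|⌉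
  refine (Set.finite_Icc (-b) b).subset fun r hr => ?_
  have hb (i : Fin N) : |r i| ≤ ⌈C * |(L i i : ℚ)|⌉ := by
    have hsq : (r i : ℚ) ^ 2 ≤ C * |(L i i : ℚ)| := (hL.sq_le_dualNorm r i).trans <|
      mul_le_mul hr (le_abs_self _) hL.posDef_ratCast.diag_pos.le
        ((hL.dualNorm_nonneg r).trans hr)
    have hle : |r i| ≤ r i ^ 2 := by
      rw [← sq_abs]
      exact Int.le_self_sq _
    have hle' : ((|r i| : ℤ) : ℚ) ≤ (r i : ℚ) ^ 2 := by exact_mod_cast hle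
    exact Int.cast_le.1 ((hle'.trans hsq).trans (Int.le_ceil _))
  exact ⟨fun i => (abs_le.1 (hb i)).1, fun i => (abs_le.1 (hb i)).2⟩

theorem finite_neigh (hL : IsJacobiIndex L) (r : Fin N → ℤ) : (neigh L r).Finite :=
  (hL.finite_setOf_dualNorm_le (dualNorm L r)).subset fun _ h => h.2.le

end IsJacobiIndex

theorem dualNorm_neg {N : ℕ} (L : Matrix (Fin N) (Fin N) ℤ) (r : Fin N → ℤ) :
    dualNorm L (-r) = dualNorm L r := by
  have hcast : (fun i => (((-r) i : ℤ) : ℚ)) = -fun i => (r i : ℚ) := by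
    ext i
    simp
  rw [dualNorm, hcast, Matrix.mulVec_neg, neg_dotProduct_neg, dualNorm]

/-- Congruence of integral vectors modulo `L ℤ^N`, up to sign. -/
def signedCongr {N : ℕ} (L : Matrix (Fin N) (Fin N) ℤ) : Setoid (Fin N → ℤ) where
  r v r := ∃ lam : Fin N → ℤ, v = r + L.mulVec lam ∨ v = -r + L.mulVec lam
  iseqv := by
    refine ⟨fun v => ⟨0, Or.inl (by simp)⟩, ?_, ?_⟩
    · rintro v r ⟨lam, h | h⟩
      · exact ⟨-lam, Or.inl (by rw [h, Matrix.mulVec_neg]; abel)⟩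
      · exact ⟨lam, Or.inr (by rw [h]; abel)⟩
    · rintro u v r ⟨lam, h | h⟩ ⟨mu, h' | h'⟩
      · exact ⟨mu + lam, Or.inl (by rw [h, h', Matrix.mulVec_add]; abel)⟩
      · exact ⟨mu + lam, Or.inr (by rw [h, h', Matrix.mulVec_add]; abel)⟩
      · exact ⟨-mu + lam, Or.inr (by rw [h, h', Matrix.mulVec_add, Matrix.mulVec_neg]; abel)⟩
      · exact ⟨-mu + lam, Or.inl (by rw [h, h', Matrix.mulVec_add, Matrix.mulVec_neg]; abel)⟩

theorem finite_quotient_signedCongr {N : ℕ} {L : Matrix (Fin N) (Fin N) ℤ} (hL : L.det ≠ 0) :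
    Finite (Quotient (signedCongr L)) := by
  have : NeZero L.det.natAbs := ⟨by simpa using hL⟩
  refine Finite.of_injective
    (fun (q : Quotient (signedCongr L)) (i : Fin N) => (q.out i : ZMod L.det.natAbs)) ?_
  intro p q hpq
  rw [← p.out_eq, ← q.out_eq]
  apply Quotient.sound
  have hdvd (i : Fin N) : L.det ∣ p.out i - q.out i := Int.natAbs_dvd.1
    ((ZMod.intCast_eq_intCast_iff_dvd_sub _ _ _).1 (congrFun hpq i).symm)
  choose m hm using hdvd
  refine ⟨L.adjugate.mulVec m, Or.inl ?_⟩
  rw [Matrix.mulVec_mulVec, Matrix.mul_adjugate, Matrix.smul_mulVec, Matrix.one_mulVec]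
  ext i
  rw [Pi.add_apply, Pi.smul_apply, smul_eq_mul, ← hm, add_sub_cancel]

theorem IsJacobiIndex.exists_minimal_representative {N : ℕ} {L : Matrix (Fin N) (Fin N) ℤ}
    (hL : IsJacobiIndex L) (q : Quotient (signedCongr L)) :
    ∃ r : Fin N → ℤ, Quotient.mk (signedCongr L) r = q ∧
      ∀ r' : Fin N → ℤ, Quotient.mk (signedCongr L) r' = q → dualNorm L r ≤ dualNorm L r' := by
  obtain ⟨r, ⟨hr, hrq⟩, hmin⟩ := Set.exists_min_image
    ({r | dualNorm L r ≤ dualNorm L q.out} ∩ {r | Quotient.mk (signedCongr L) r = q})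
    (dualNorm L) ((hL.finite_setOf_dualNorm_le _).inter_of_left _)
    ⟨q.out, le_refl (dualNorm L q.out), q.out_eq⟩
  refine ⟨r, hrq, fun r' hr' => ?_⟩
  rcases le_total (dualNorm L r') (dualNorm L q.out) with h | h
  · exact hmin r' ⟨h, hr'⟩
  · exact hr.trans h

theorem IsJacobiIndex.exists_isMinimalRepSystem {N : ℕ} {L : Matrix (Fin N) (Fin N) ℤ}
    (hL : IsJacobiIndex L) : ∃ R, IsMinimalRepSystem L R := by
  choose m hm hmin using hL.exists_minimal_representative
  have := finite_quotient_signedCongr hL.det_ne_zero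
  have hmem (r : Fin N → ℤ) : r ∈ (Set.finite_range m).toFinset ↔ ∃ q, m q = r := by simp
  refine ⟨(Set.finite_range m).toFinset, fun v => ?_, fun r hr lam => ?_⟩
  · refine ⟨m (Quotient.mk _ v), ⟨(hmem _).2 ⟨_, rfl⟩, Quotient.exact (hm _).symm⟩, ?_⟩
    rintro r ⟨hr, hvr⟩
    obtain ⟨q, rfl⟩ := (hmem r).1 hr
    rw [(Quotient.sound hvr).trans (hm q)]
  · obtain ⟨q, rfl⟩ := (hmem r).1 hr
    refine hmin q _ ((Quotient.sound ?_).trans (hm q))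
    exact ⟨lam, Or.inl rfl⟩

/-! ### Existence of test sets -/

section HyperplaneAvoidance

variable {R : Type*} [CommRing R] [IsDomain R]

theorem eventually_cofinite_mul_add_ne_zero {a b : R} (h : a ≠ 0 ∨ b ≠ 0) :
    ∀ᶠ K : R in Filter.cofinite, K * a + b ≠ 0 := by
  rcases eq_or_ne a 0 with rfl | ha
  · exact Filter.Eventually.of_forall fun K => by simpa using h
  · exact (((add_left_injective b).comp (mul_left_injective₀ ha)).tendsto_cofinite).eventually
      (Filter.eventually_cofinite_ne 0)

variable [Infinite R] {ι : Type*} [Fintype ι]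

theorem exists_forall_dotProduct_ne_zero {D : Set (ι → R)} (hD : D.Finite) (h0 : 0 ∉ D) :
    ∃ v : ι → R, ∀ d ∈ D, v ⬝ᵥ d ≠ 0 := by
  induction D, hD using Set.Finite.induction_on with
  | empty => simp
  | @insert d D _ hD ih =>
    rw [Set.mem_insert_iff, not_or] at h0
    obtain ⟨v, hv⟩ := ih h0.2
    obtain ⟨w, hw⟩ : ∃ w, d ⬝ᵥ w ≠ 0 := by
      by_contra! h
      exact h0.1 (dotProduct_eq_zero d h).symm
    have hK : ∀ d' ∈ insert d D, ∀ᶠ K : R in Filter.cofinite, K * (v ⬝ᵥ d') + w ⬝ᵥ d' ≠ 0 := by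
      rintro d' (rfl | hd')
      · exact eventually_cofinite_mul_add_ne_zero (Or.inr (dotProduct_comm w d' ▸ hw))
      · exact eventually_cofinite_mul_add_ne_zero (Or.inl (hv d' hd'))
    obtain ⟨K, hK⟩ := ((Filter.eventually_all_finite (hD.insert d)).2 hK).exists
    exact ⟨K • v + w, by simpa only [add_dotProduct, smul_dotProduct, smul_eq_mul] using hK⟩

theorem exists_span_eq_top_forall_dotProduct_ne_zero {D : Set (ι → R)} (hD : D.Finite)
    (h0 : 0 ∉ D) :
    ∃ T : Finset (ι → R), Submodule.span R (T : Set (ι → R)) = ⊤ ∧ 0 ∉ T ∧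
      ∀ s ∈ T, ∀ d ∈ D, s ⬝ᵥ d ≠ 0 := by
  classical
  obtain ⟨v, hv⟩ := exists_forall_dotProduct_ne_zero hD h0
  obtain ⟨K, hK⟩ : ∃ K : R, ∀ d ∈ D, ∀ i, K * (v ⬝ᵥ d) + d i ≠ 0 := Filter.Eventually.exists <|
    (Filter.eventually_all_finite hD).2 fun d hd => Filter.eventually_all.2 fun i =>
      eventually_cofinite_mul_add_ne_zero (Or.inl (hv d hd))
  let T : Finset (ι → R) := insert v (Finset.univ.image fun i => K • v + Pi.single i 1)
  refine ⟨T.erase 0, ?_, T.notMem_erase 0, fun s hs d hd => ?_⟩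
  · rw [Finset.coe_erase, Submodule.span_sdiff_singleton_zero, eq_top_iff,
      ← (Pi.basisFun R ι).span_eq, Submodule.span_le]
    rintro _ ⟨i, rfl⟩
    have hvT : v ∈ Submodule.span R (T : Set (ι → R)) :=
      Submodule.subset_span (Finset.mem_insert_self v _)
    have hiT : K • v + Pi.single i 1 ∈ Submodule.span R (T : Set (ι → R)) :=
      Submodule.subset_span <|
        Finset.mem_insert_of_mem <| Finset.mem_image_of_mem _ <| Finset.mem_univ i
    simpa using Submodule.sub_mem _ hiT (Submodule.smul_mem _ K hvT)
  · rcases Finset.mem_insert.1 (Finset.mem_of_mem_erase hs) with rfl | hs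
    · exact hv d hd
    · obtain ⟨i, -, rfl⟩ := Finset.mem_image.1 hs
      simpa only [add_dotProduct, smul_dotProduct, single_dotProduct, one_mul, smul_eq_mul] using
        hK d hd i

end HyperplaneAvoidance

section TestSets

variable {N : ℕ} {L st : Matrix (Fin N) (Fin N) ℤ}

theorem dotProduct_transpose_adjugate_mulVec {l : ℤ} {s s' : Fin N → ℤ}
    (h : st.mulVec s = l • s') (x : Fin N → ℤ) :
    l * (s' ⬝ᵥ st.adjugate.transpose.mulVec x) = st.det * (s ⬝ᵥ x) := by
  rw [Matrix.mulVec_transpose, dotProduct_comm, ← Matrix.dotProduct_mulVec, ← smul_eq_mul,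
    ← dotProduct_smul, ← Matrix.mulVec_smul, ← h, Matrix.mulVec_mulVec, Matrix.adjugate_mul,
    Matrix.smul_mulVec, Matrix.one_mulVec, dotProduct_smul, smul_eq_mul, dotProduct_comm]

theorem IsJacobiIndex.exists_isStrongRestrictionSet (hL : IsJacobiIndex L) (hst : st.det ≠ 0)
    {l : ℤ} (hl : l ≠ 0) (R : Finset (Fin N → ℤ)) (r : Fin N → ℤ) :
    ∃ T, IsStrongRestrictionSet L st l R r T := by
  have hM : (⋃ r₀ ∈ R, (neigh L r₀ ∪ neigh L (-r₀))).Finite := R.finite_toSet.biUnion fun r₀ _ =>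
    (hL.finite_neigh r₀).union (hL.finite_neigh (-r₀))
  have hadj : st.adjugate.transpose.det ≠ 0 := by
    rw [Matrix.det_transpose, Matrix.det_adjugate]
    exact pow_ne_zero _ hst
  obtain ⟨T, hspan, hT0, hsep⟩ := exists_span_eq_top_forall_dotProduct_ne_zero
    ((hM.sdiff (t := {r})).image fun r' => st.adjugate.transpose.mulVec (r - r')) (by
      rintro ⟨r', ⟨-, hr'⟩, h0⟩
      exact hr' (sub_eq_zero.1 (Matrix.eq_zero_of_mulVec_eq_zero hadj h0)).symm)
  refine ⟨T, fun s' hs' h0 => hT0 (h0 ▸ hs'), hspan, fun s' hs' s hs r₀ hr₀ r' hr' hdot => ?_⟩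
  by_contra hrr
  refine hsep s' hs' _ (Set.mem_image_of_mem _ ⟨Set.mem_biUnion hr₀ hr', Ne.symm hrr⟩) ?_
  have h := dotProduct_transpose_adjugate_mulVec hs (r - r')
  rw [dotProduct_sub s, hdot, sub_self, mul_zero] at h
  exact (mul_eq_zero.1 h).resolve_left hl

theorem IsJacobiIndex.exists_isOldformTestSet (hL : IsJacobiIndex L) (hst : st.det ≠ 0) :
    ∃ S, IsOldformTestSet L st S := by
  classical
  obtain ⟨R, hR⟩ := hL.exists_isMinimalRepSystem
  choose T hT using hL.exists_isStrongRestrictionSet hst (pow_ne_zero 2 hst) R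
  have hinj := Matrix.mulVec_injective_of_det_ne_zero hst
  refine ⟨(R.biUnion fun r => (T r).image (st.det ^ 2 • ·)).preimage st.mulVec hinj.injOn,
    st.det ^ 2, R, T, by positivity, fun v => ⟨st.det • st.adjugate.mulVec v, ?_⟩, hR,
    fun r _ => hT r, fun s => ?_⟩
  · rw [Matrix.mulVec_smul, Matrix.mulVec_mulVec, Matrix.mul_adjugate, Matrix.smul_mulVec,
      Matrix.one_mulVec, smul_smul, sq]
  · simp only [Finset.mem_preimage, Finset.mem_biUnion, Finset.mem_image, eq_comm]

end TestSets

theorem det_ne_zero_of_gramPullback {N : ℕ} {L' st : Matrix (Fin N) (Fin N) ℤ}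
    (h : (gramPullback L' st).det ≠ 0) : st.det ≠ 0 := fun h0 =>
  h (by rw [gramPullback, Matrix.det_mul, h0, mul_zero])

/-! ### Support of the Fourier coefficients -/

theorem integral_expTwoPiI_intCast_mul (j : ℤ) :
    ∫ x in (0 : ℝ)..1, expTwoPiI (j * x) = if j = 0 then 1 else 0 := by
  split_ifs with hj
  · simp [hj, expTwoPiI_zero]
  · have hc : (2 * Real.pi * Complex.I * j : ℂ) ≠ 0 :=
      mul_ne_zero Complex.two_pi_I_ne_zero (Int.cast_ne_zero.2 hj)
    have hexp : Complex.exp (2 * Real.pi * Complex.I * j) = 1 := expTwoPiI_intCast j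
    simp only [expTwoPiI, ← mul_assoc]
    rw [integral_exp_mul_complex hc]
    simp [hexp]

theorem sum_filter_eq_zero_of_sum_mul_expTwoPiI_eq_zero {α : Type*} (B : Finset α) (a : α → ℂ)
    (f : α → ℤ) (h : ∀ x : ℝ, ∑ r ∈ B, a r * expTwoPiI (f r * x) = 0) (m : ℤ) :
    ∑ r ∈ B with f r = m, a r = 0 := by
  have hexp (r : α) (x : ℝ) : expTwoPiI (f r * x) * expTwoPiI (-m * x) =
      expTwoPiI (((f r - m : ℤ) : ℂ) * x) := by
    rw [← expTwoPiI_add]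
    push_cast
    ring_nf
  have hint : ∫ x in (0 : ℝ)..1, ∑ r ∈ B, a r * expTwoPiI (((f r - m : ℤ) : ℂ) * x) = 0 := by
    simp only [← hexp, ← mul_assoc, ← Finset.sum_mul, h, zero_mul,
      intervalIntegral.integral_zero]
  rw [intervalIntegral.integral_finsetSum fun r _ =>
    Continuous.intervalIntegrable (by fun_prop) _ _] at hint
  simpa only [intervalIntegral.integral_const_mul, integral_expTwoPiI_intCast_mul, sub_eq_zero,
    mul_ite, mul_one, mul_zero, ← Finset.sum_filter] using hint

theorem expTwoPiI_intCast_div_eq_one_iff {m c : ℤ} (hc : c ≠ 0) :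
    expTwoPiI ((m : ℂ) / c) = 1 ↔ c ∣ m := by
  have hc' : (c : ℂ) ≠ 0 := Int.cast_ne_zero.2 hc
  rw [expTwoPiI, Complex.exp_eq_one_iff]
  refine exists_congr fun j => ?_
  rw [mul_comm (j : ℂ), mul_right_inj' Complex.two_pi_I_ne_zero, div_eq_iff hc', mul_comm c]
  norm_cast

theorem expDot_transpose_mulVec {ι κ : Type*} [Fintype ι] [Fintype κ] (M : Matrix κ ι ℤ)
    (q : κ → ℤ) (z : ι → ℂ) :
    expDot (M.transpose.mulVec q) z = expDot q ((M.map (Int.cast : ℤ → ℂ)).mulVec z) := by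
  have htranspose (x : κ → ℂ) : (M.transpose.map (Int.cast : ℤ → ℂ)).mulVec x ⬝ᵥ z =
      x ⬝ᵥ (M.map (Int.cast : ℤ → ℂ)).mulVec z := by
    rw [Matrix.transpose_map, Matrix.mulVec_transpose, ← Matrix.dotProduct_mulVec]
  exact congrArg expTwoPiI <|
    (congrArg (· ⬝ᵥ z) (intCast_mulVec M.transpose q)).trans (htranspose _)

theorem sum_jacobiFourierCoeff_eq_zero {ι : Type*} [Fintype ι] {Φ : ℂ → (ι → ℂ) → ℂ} {n : ℤ}
    {B : Finset (ι → ℤ)}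
    (hB : ∀ z, fourierJacobiCoeff Φ n z = ∑ r ∈ B, jacobiFourierCoeff Φ n r * expDot r z)
    {s : ι → ℤ} {c m : ℤ} (hc : c ≠ 0) (hcm : ¬ c ∣ m)
    (hper : ∀ t : ℂ, 0 < t.im →
      Function.Periodic (fun x : ℂ => Φ t (x • fun i => (s i : ℂ))) (1 / c)) :
    ∑ r ∈ B with s ⬝ᵥ r = m, jacobiFourierCoeff Φ n r = 0 := by
  have hcoeff (x : ℝ) : fourierJacobiCoeff Φ n (((x : ℂ) + 1 / c) • fun i => (s i : ℂ)) =
      fourierJacobiCoeff Φ n ((x : ℂ) • fun i => (s i : ℂ)) := by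
    unfold fourierJacobiCoeff
    congr with y
    exact congrArg (· * _) (hper _ (by simp) x)
  have hsum := sum_filter_eq_zero_of_sum_mul_expTwoPiI_eq_zero B
    (fun r => jacobiFourierCoeff Φ n r * (expTwoPiI (((s ⬝ᵥ r : ℤ) : ℂ) / c) - 1))
    (fun r => s ⬝ᵥ r) (fun x => by
      rw [← sub_eq_zero.2 (hcoeff x), hB, hB, ← Finset.sum_sub_distrib]
      refine Finset.sum_congr rfl fun r _ => ?_
      rw [expDot_smul_intCast, expDot_smul_intCast, add_mul, expTwoPiI_add, dotProduct_comm r,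
        one_div_mul_eq_div, mul_comm (x : ℂ)]
      ring) m
  rw [Finset.sum_congr rfl (g := fun r => jacobiFourierCoeff Φ n r * (expTwoPiI ((m : ℂ) / c) - 1))
    (fun r hr => by rw [(Finset.mem_filter.1 hr).2]), ← Finset.sum_mul] at hsum
  exact (mul_eq_zero.1 hsum).resolve_right
    (sub_ne_zero.2 fun h1 => hcm ((expTwoPiI_intCast_div_eq_one_iff hc).1 h1))

theorem IsJacobiIndex.even_dotProduct_mulVec {N : ℕ} {L : Matrix (Fin N) (Fin N) ℤ}
    (hL : IsJacobiIndex L) (lam : Fin N → ℤ) : Even (lam ⬝ᵥ L.mulVec lam) := by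
  rw [even_iff_two_dvd, ← Nat.cast_ofNat, ← ZMod.intCast_zmod_eq_zero_iff_dvd]
  have hsum : lam ⬝ᵥ L.mulVec lam = ∑ p : Fin N × Fin N, lam p.1 * (L p.1 p.2 * lam p.2) := by
    simp only [dotProduct, Matrix.mulVec, Finset.mul_sum, Fintype.sum_prod_type]
  rw [hsum, Int.cast_sum]
  refine Finset.sum_involution (fun p _ => p.swap) ?_ ?_ (by simp) (by simp)
  · rintro ⟨i, j⟩ _
    have hswap : lam j * (L j i * lam i) = lam i * (L i j * lam j) := by
      rw [hL.symm.apply i j]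
      ring
    simp only [Prod.swap, hswap]
    exact CharTwo.add_self_eq_zero _
  · rintro ⟨i, j⟩ _ hne hij
    obtain rfl : j = i := congrArg Prod.fst hij
    obtain ⟨c, hc⟩ := hL.even j
    refine hne ?_
    simp only [hc]
    push_cast
    rw [CharTwo.add_self_eq_zero, zero_mul, mul_zero]

theorem IsMinimalRepSystem.exists_eq_add_mulVec {N : ℕ} {L : Matrix (Fin N) (Fin N) ℤ}
    {R : Finset (Fin N → ℤ)} (hR : IsMinimalRepSystem L R) (r : Fin N → ℤ) :
    ∃ r₀ ∈ R, ∃ q, (q = r₀ ∨ q = -r₀) ∧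
      ∃ lam, r = q + L.mulVec lam ∧ dualNorm L q ≤ dualNorm L r := by
  obtain ⟨r₀, ⟨hr₀, lam, rfl | rfl⟩, -⟩ := hR.existsUnique r
  · exact ⟨r₀, hr₀, r₀, Or.inl rfl, lam, rfl, hR.minimal r₀ hr₀ lam⟩
  · refine ⟨r₀, hr₀, -r₀, Or.inr rfl, lam, rfl, ?_⟩
    rw [dualNorm_neg, ← dualNorm_neg L (-r₀ + _), neg_add, neg_neg, ← Matrix.mulVec_neg]
    exact hR.minimal r₀ hr₀ (-lam)

namespace IsParabolicForm

variable {N : ℕ} {k : ℤ} {L : Matrix (Fin N) (Fin N) ℤ} {Φ : ℂ → (Fin N → ℂ) → ℂ}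

theorem exists_jacobiFourierCoeff_eq (h : IsParabolicForm k L Φ) (hL : IsJacobiIndex L)
    {R : Finset (Fin N → ℤ)} (hR : IsMinimalRepSystem L R) (n : ℤ) (r : Fin N → ℤ) :
    ∃ r₀ ∈ R, ∃ q, (q = r₀ ∨ q = -r₀) ∧ ∃ lam, r = q + L.mulVec lam ∧
      ∃ E : ℤ, 0 ≤ E ∧ dualNorm L r = dualNorm L q + 2 * E ∧
        jacobiFourierCoeff Φ n r = jacobiFourierCoeff Φ (n - E) q := by
  obtain ⟨r₀, hr₀, q, hq, lam, rfl, hle⟩ := hR.exists_eq_add_mulVec r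
  obtain ⟨c, hc⟩ := hL.even_dotProduct_mulVec lam
  have hE : 2 * (q ⬝ᵥ lam + c) = 2 * (q ⬝ᵥ lam) + lam ⬝ᵥ L.mulVec lam := by
    rw [hc]
    ring
  have hnorm : dualNorm L (q + L.mulVec lam) =
      dualNorm L q + 2 * ((q ⬝ᵥ lam + c : ℤ) : ℚ) := by
    rw [hL.dualNorm_add_mulVec, ← hE]
    push_cast
    ring
  refine ⟨r₀, hr₀, q, hq, lam, rfl, q ⬝ᵥ lam + c, ?_, hnorm, ?_⟩
  · have hE0 : (0 : ℚ) ≤ ((q ⬝ᵥ lam + c : ℤ) : ℚ) := by linarith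
    exact_mod_cast hE0
  · rw [← h.jacobiFourierCoeff_add_mulVec hE, sub_add_cancel]

theorem finite_support_jacobiFourierCoeff (h : IsParabolicForm k L Φ) (hL : IsJacobiIndex L)
    (n : ℤ) : {r | jacobiFourierCoeff Φ n r ≠ 0}.Finite := by
  obtain ⟨R, hR⟩ := hL.exists_isMinimalRepSystem
  refine (R.finite_toSet.biUnion fun r₀ _ =>
    hL.finite_setOf_dualNorm_le (dualNorm L r₀ + 2 * n)).subset fun r hr => ?_
  obtain ⟨r₀, hr₀, q, hq, lam, -, E, -, hnorm, hc⟩ := h.exists_jacobiFourierCoeff_eq hL hR n r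
  have hEn : 0 ≤ n - E := by
    by_contra! hneg
    exact hr (hc.trans (h.jacobiFourierCoeff_eq_zero_of_neg hneg q))
  have hEn' : (E : ℚ) ≤ n := by exact_mod_cast sub_nonneg.1 hEn
  have hq' : dualNorm L q = dualNorm L r₀ := by
    rcases hq with rfl | rfl
    · rfl
    · exact dualNorm_neg L r₀
  refine Set.mem_biUnion hr₀ (show dualNorm L r ≤ _ from ?_)
  linarith

theorem exists_finset_fourierJacobiCoeff_eq_sum (h : IsParabolicForm k L Φ)
    (hL : IsJacobiIndex L) (n : ℤ) :
    ∃ B : Finset (Fin N → ℤ), (∀ r, r ∈ B ↔ jacobiFourierCoeff Φ n r ≠ 0) ∧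
      ∀ z, fourierJacobiCoeff Φ n z = ∑ r ∈ B, jacobiFourierCoeff Φ n r * expDot r z := by
  have hB := h.finite_support_jacobiFourierCoeff hL n
  refine ⟨hB.toFinset, fun r => hB.mem_toFinset, fun z => h.fourierJacobiCoeff_eq_sum ?_ z⟩
  simp

theorem comp_add_eq_of_expDot_eq_one (h : IsParabolicForm k L Φ) (hL : IsJacobiIndex L)
    {w : Fin N → ℂ} (hw : ∀ n r, jacobiFourierCoeff Φ n r ≠ 0 → expDot r w = 1)
    {t : ℂ} (ht : 0 < t.im) (z : Fin N → ℂ) : Φ t (z + w) = Φ t z := by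
  refine h.comp_add_eq_of_fourierJacobiCoeff (fun n z => ?_) ht z
  obtain ⟨B, hB, hsum⟩ := h.exists_finset_fourierJacobiCoeff_eq_sum hL n
  rw [hsum, hsum]
  refine Finset.sum_congr rfl fun r hr => ?_
  rw [expDot_add_right, hw n r ((hB r).1 hr), mul_one]

theorem exists_minimal_support_notMem (h : IsParabolicForm k L Φ) (hL : IsJacobiIndex L)
    {R : Finset (Fin N → ℤ)} (hR : IsMinimalRepSystem L R) {D : AddSubgroup (Fin N → ℤ)}
    (hD : ∀ lam, L.mulVec lam ∈ D) {n : ℤ} {r : Fin N → ℤ} (hr : r ∉ D)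
    (hn : jacobiFourierCoeff Φ n r ≠ 0) :
    ∃ n, (∃ r₀ ∈ R, r₀ ∉ D ∧ jacobiFourierCoeff Φ n r₀ ≠ 0) ∧
      ∀ r ∉ D, jacobiFourierCoeff Φ n r ≠ 0 → ∃ r₀ ∈ R, r ∈ neigh L r₀ ∪ neigh L (-r₀) := by
  obtain ⟨n, ⟨r₁, hr₁, hne₁⟩, hleast⟩ := Int.exists_least_of_bdd
    (P := fun n => ∃ r, r ∉ D ∧ jacobiFourierCoeff Φ n r ≠ 0)
    ⟨0, fun n ⟨r, _, hr⟩ => by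
      by_contra! hneg
      exact hr (h.jacobiFourierCoeff_eq_zero_of_neg hneg r)⟩ ⟨n, r, hr, hn⟩
  have hmin (r : Fin N → ℤ) (hr : r ∉ D) (hne : jacobiFourierCoeff Φ n r ≠ 0) :
      ∃ r₀ ∈ R, ∃ q, (q = r₀ ∨ q = -r₀) ∧ r ∈ neigh L q ∧ q ∉ D ∧
        jacobiFourierCoeff Φ n q ≠ 0 := by
    obtain ⟨r₀, hr₀, q, hq, lam, hrq, E, hE0, hnorm, hc⟩ := h.exists_jacobiFourierCoeff_eq hL hR n r
    have hqD : q ∉ D := fun hqD => hr (hrq ▸ D.add_mem hqD (hD lam))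
    obtain rfl : E = 0 := by linarith [hleast (n - E) ⟨q, hqD, hc ▸ hne⟩]
    rw [sub_zero] at hc
    exact ⟨r₀, hr₀, q, hq, ⟨⟨lam, hrq⟩, by simpa using hnorm⟩, hqD, hc ▸ hne⟩
  refine ⟨n, ?_, fun r hr hne => ?_⟩
  · obtain ⟨r₀, hr₀, q, rfl | rfl, -, hqD, hqne⟩ := hmin r₁ hr₁ hne₁
    · exact ⟨q, hr₀, hqD, hqne⟩
    · rw [h.jacobiFourierCoeff_neg] at hqne
      exact ⟨r₀, hr₀, fun hD' => hqD (D.neg_mem hD'), right_ne_zero_of_mul hqne⟩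
  · obtain ⟨r₀, hr₀, q, rfl | rfl, hneigh, -⟩ := hmin r hr hne
    · exact ⟨q, hr₀, Or.inl hneigh⟩
    · exact ⟨r₀, hr₀, Or.inr hneigh⟩

end IsParabolicForm

theorem exists_eq_smul_of_span_eq_top {R ι : Type*} [CommRing R] [Fintype ι] {T : Set (ι → R)}
    (hT : Submodule.span R T = ⊤) {d : R} {x : ι → R} (h : ∀ v ∈ T, d ∣ v ⬝ᵥ x) :
    ∃ q, x = d • q := by
  classical
  have hall (v : ι → R) : d ∣ v ⬝ᵥ x := by
    have hv : v ∈ Submodule.span R T := hT ▸ Submodule.mem_top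
    induction hv using Submodule.span_induction with
    | mem v hv => exact h v hv
    | zero => simp
    | add v w _ _ hv hw => exact add_dotProduct v w x ▸ hv.add hw
    | smul a v _ hv => exact smul_dotProduct a v x ▸ hv.mul_left a
  choose q hq using fun i => hall (Pi.single i 1)
  exact ⟨q, funext fun i => by simpa using hq i⟩

section TestVectors

variable {N : ℕ} {L L' st : Matrix (Fin N) (Fin N) ℤ} {l : ℤ} {r s s' : Fin N → ℤ}

theorem gramPullback_mulVec_mem_range (lam : Fin N → ℤ) :
    (gramPullback L' st).mulVec lam ∈ LinearMap.range st.transpose.mulVecLin :=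
  ⟨L'.mulVec (st.mulVec lam), by
    rw [Matrix.mulVecLin_apply, Matrix.mulVec_mulVec, Matrix.mulVec_mulVec, gramPullback,
      Matrix.mul_assoc]⟩

theorem dvd_contentOf (h : st.mulVec s = l • s') : l ∣ contentOf st s := by
  refine Finset.dvd_gcd fun i _ => ?_
  rw [h]
  exact dvd_mul_right _ _

theorem contentOf_dvd_dotProduct (hr : r ∈ LinearMap.range st.transpose.mulVecLin) :
    contentOf st s ∣ s ⬝ᵥ r := by
  obtain ⟨q, rfl⟩ := hr
  rw [Matrix.mulVecLin_apply, Matrix.mulVec_transpose, dotProduct_comm, ← Matrix.dotProduct_mulVec]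
  exact Finset.dvd_sum fun i hi => (Finset.gcd_dvd hi).mul_left _

theorem exists_not_dvd_dotProduct (hst : st.det ≠ 0) (hl : l ≠ 0)
    (hlst : ∀ v, ∃ w, st.mulVec w = l • v) {T : Set (Fin N → ℤ)}
    (hT : Submodule.span ℤ T = ⊤) (hr : r ∉ LinearMap.range st.transpose.mulVecLin) :
    ∃ s' ∈ T, ∃ s, st.mulVec s = l • s' ∧ ¬ l ∣ s ⬝ᵥ r := by
  by_contra! hdvd
  obtain ⟨q, hq⟩ := exists_eq_smul_of_span_eq_top hT (d := st.det)
    (x := st.adjugate.transpose.mulVec r) fun s' hs' => by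
      obtain ⟨s, hs⟩ := hlst s'
      obtain ⟨a, ha⟩ := hdvd s' hs' s hs
      refine ⟨a, mul_left_cancel₀ hl ?_⟩
      rw [dotProduct_transpose_adjugate_mulVec hs, ha, mul_left_comm]
  refine hr ⟨q, smul_right_injective _ hst (?_ : st.det • _ = st.det • r)⟩
  rw [Matrix.mulVecLin_apply, ← Matrix.mulVec_smul, ← hq, Matrix.mulVec_mulVec,
    ← Matrix.transpose_mul, Matrix.adjugate_mul, Matrix.transpose_smul, Matrix.transpose_one,
    Matrix.smul_mulVec, Matrix.one_mulVec]

variable {k : ℤ} {Φ : ℂ → (Fin N → ℂ) → ℂ} {S : Finset (Fin N → ℤ)}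

theorem IsParabolicForm.mem_range_of_jacobiFourierCoeff_ne_zero (h : IsParabolicForm k L Φ)
    (hL : IsJacobiIndex L) (hLL' : L = gramPullback L' st) (hS : IsOldformTestSet L st S)
    (hper : ∀ s ∈ S, ∀ t : ℂ, 0 < t.im →
      Function.Periodic (fun x : ℂ => Φ t (x • fun i => (s i : ℂ))) (1 / contentOf st s))
    {n : ℤ} (hn : jacobiFourierCoeff Φ n r ≠ 0) :
    r ∈ LinearMap.range st.transpose.mulVecLin := by
  by_contra hr
  have ⟨l, R, T, hl, hlst, hR, hT, hSmem⟩ := hS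
  have hst : st.det ≠ 0 := det_ne_zero_of_gramPullback (hLL' ▸ hL.det_ne_zero)
  obtain ⟨n, ⟨r₀, hr₀, hr₀D, hne⟩, hmin⟩ := h.exists_minimal_support_notMem hL hR
    (D := (LinearMap.range st.transpose.mulVecLin).toAddSubgroup)
    (fun lam => hLL' ▸ gramPullback_mulVec_mem_range lam) hr hn
  obtain ⟨s', hs', s, hs, hndvd⟩ :=
    exists_not_dvd_dotProduct hst hl.ne' hlst (hT r₀ hr₀).span_eq_top hr₀D
  have hsS : s ∈ S := (hSmem s).2 ⟨r₀, hr₀, s', hs', hs⟩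
  have hcontent : ¬ contentOf st s ∣ s ⬝ᵥ r₀ := fun hdvd => hndvd ((dvd_contentOf hs).trans hdvd)
  obtain ⟨B, hB, hBsum⟩ := h.exists_finset_fourierJacobiCoeff_eq_sum hL n
  have hsum := sum_jacobiFourierCoeff_eq_zero hBsum (hS.contentOf_ne_zero hsS) hcontent
    (hper s hsS)
  have hmem : r₀ ∈ B.filter fun r => s ⬝ᵥ r = s ⬝ᵥ r₀ :=
    Finset.mem_filter.2 ⟨(hB r₀).2 hne, rfl⟩
  rw [Finset.sum_eq_single_of_mem r₀ hmem] at hsum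
  · exact hne hsum
  · intro r hr hrne
    obtain ⟨hrB, hdot⟩ := Finset.mem_filter.1 hr
    have hrD : r ∉ LinearMap.range st.transpose.mulVecLin := fun hrD =>
      hcontent (hdot ▸ contentOf_dvd_dotProduct hrD)
    obtain ⟨r₁, hr₁, hneigh⟩ := hmin r hrD ((hB r).1 hrB)
    exact absurd ((hT r₀ hr₀).separates s' hs' s hs r₁ hr₁ r hneigh hdot.symm).symm hrne

theorem IsParabolicForm.comp_add_eq_of_isOldformTestSet (h : IsParabolicForm k L Φ)
    (hL : IsJacobiIndex L) (hLL' : L = gramPullback L' st) (hS : IsOldformTestSet L st S)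
    (hper : ∀ s ∈ S, ∀ t : ℂ, 0 < t.im →
      Function.Periodic (fun x : ℂ => Φ t (x • fun i => (s i : ℂ))) (1 / contentOf st s))
    {w : Fin N → ℂ} {m : Fin N → ℤ}
    (hw : (st.map (Int.cast : ℤ → ℂ)).mulVec w = fun i => (m i : ℂ))
    {t : ℂ} (ht : 0 < t.im) (z : Fin N → ℂ) : Φ t (z + w) = Φ t z := by
  refine h.comp_add_eq_of_expDot_eq_one hL (fun n r hn => ?_) ht z
  obtain ⟨q, rfl⟩ := h.mem_range_of_jacobiFourierCoeff_ne_zero hL hLL' hS hper hn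
  have hqm := expDot_smul_intCast q m 1
  rw [one_smul, one_mul, expTwoPiI_intCast] at hqm
  rw [Matrix.mulVecLin_apply, expDot_transpose_mulVec, hw, hqm]

end TestVectors

/-! ### Transformation laws -/

section Bilin

variable {N M : ℕ} {L : Matrix (Fin N) (Fin N) ℤ}

theorem bilin_intCast (x y : Fin N → ℤ) :
    bilin L (fun i => (x i : ℂ)) (fun i => (y i : ℂ)) = ((x ⬝ᵥ L.mulVec y : ℤ) : ℂ) := by
  rw [bilin, ← intCast_mulVec, ← intCast_dotProduct]

theorem bilin_comm (hL : L.IsSymm) (x y : Fin N → ℂ) : bilin L x y = bilin L y x := by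
  rw [bilin, bilin, Matrix.dotProduct_mulVec, ← Matrix.mulVec_transpose, (hL.map _).eq,
    dotProduct_comm]

theorem expTwoPiI_bilin_intCast (hL : L.IsSymm) (lam : Fin N → ℤ) (z : Fin N → ℂ) :
    expTwoPiI (bilin L (fun i => (lam i : ℂ)) z) = expDot (L.mulVec lam) z := by
  rw [bilin_comm hL, bilin, ← intCast_mulVec, dotProduct_comm]
  rfl

theorem bilin_add_smul_add_smul (hL : L.IsSymm) (z v : Fin N → ℂ) (t : ℂ) :
    bilin L (z + t • v) (z + t • v) = bilin L z z + 2 * t * bilin L v z + t ^ 2 * bilin L v v := by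
  have hcomm := bilin_comm hL v z
  simp only [bilin, Matrix.mulVec_add, Matrix.mulVec_smul, add_dotProduct, dotProduct_add,
    smul_dotProduct, dotProduct_smul, smul_eq_mul] at hcomm ⊢
  rw [hcomm]
  ring

theorem bilin_gramPullback (s : Matrix (Fin N) (Fin M) ℤ) (x y : Fin M → ℂ) :
    bilin (gramPullback L s) x y =
      bilin L ((s.map (Int.cast : ℤ → ℂ)).mulVec x) ((s.map (Int.cast : ℤ → ℂ)).mulVec y) := by
  have hmap : (gramPullback L s).map (Int.cast : ℤ → ℂ) =
      (s.map (Int.cast : ℤ → ℂ)).transpose * L.map (Int.cast : ℤ → ℂ) *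
        s.map (Int.cast : ℤ → ℂ) := by
    have hmul := Matrix.map_mul (L := s.transpose * L) (M := s) (f := Int.castRingHom ℂ)
    rwa [Matrix.map_mul (L := s.transpose)] at hmul
  rw [bilin, hmap, ← Matrix.mulVec_mulVec, ← Matrix.mulVec_mulVec, Matrix.mulVec_transpose,
    dotProduct_comm, ← Matrix.dotProduct_mulVec, dotProduct_comm, bilin]

end Bilin

section JacobiSlash

variable {N M : ℕ} {k : ℤ} {L : Matrix (Fin N) (Fin N) ℤ} {φ : ℍ × (Fin N → ℂ) → ℂ}

theorem jacobiSlash_zero_zero_apply (γ : SL(2, ℤ)) (τ : ℍ) (z : Fin N → ℂ) :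
    jacobiSlash k L φ γ 0 0 (τ, z) = ((γ 1 0 : ℤ) * τ + (γ 1 1 : ℤ) : ℂ) ^ (-k) *
      expTwoPiI (-(γ 1 0 : ℤ) * bilin L z z / (2 * ((γ 1 0 : ℤ) * τ + (γ 1 1 : ℤ)))) *
      φ (γ • τ, ((γ 1 0 : ℤ) * τ + (γ 1 1 : ℤ) : ℂ)⁻¹ • z) := by
  simp [jacobiSlash, bilin, div_eq_inv_mul, ← Pi.zero_def, Pi.smul_def]

theorem jacobiSlash_apply (γ : SL(2, ℤ)) (lam mu : Fin N → ℤ) (τ : ℍ) (z : Fin N → ℂ) :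
    jacobiSlash k L φ γ lam mu (τ, z) =
      expTwoPiI (τ * bilin L (fun i => (lam i : ℂ)) (fun i => (lam i : ℂ)) / 2 +
          bilin L (fun i => (lam i : ℂ)) z) *
        jacobiSlash k L φ γ 0 0
          (τ, z + (τ : ℂ) • (fun i => (lam i : ℂ)) + fun i => (mu i : ℂ)) := by
  rw [jacobiSlash_zero_zero_apply]
  have hshift : (fun i => z i + lam i * (τ : ℂ) + mu i) =
      z + (τ : ℂ) • (fun i => (lam i : ℂ)) + fun i => (mu i : ℂ) := by
    ext i
    simp [mul_comm]
  simp only [jacobiSlash, congrFun hshift, add_assoc, expTwoPiI_add, div_eq_inv_mul]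
  simp only [Pi.smul_def, smul_eq_mul]
  ring

theorem forall_jacobiSlash_eq_iff :
    (∀ γ lam mu, jacobiSlash k L φ γ lam mu = φ) ↔
      (∀ γ, jacobiSlash k L φ γ 0 0 = φ) ∧
      ∀ (τ : ℍ) z (lam mu : Fin N → ℤ),
        expTwoPiI (τ * bilin L (fun i => (lam i : ℂ)) (fun i => (lam i : ℂ)) / 2 +
            bilin L (fun i => (lam i : ℂ)) z) *
          φ (τ, z + (τ : ℂ) • (fun i => (lam i : ℂ)) + fun i => (mu i : ℂ)) = φ (τ, z) := by
  refine ⟨fun h => ⟨fun γ => h γ 0 0, fun τ z lam mu => ?_⟩, fun ⟨hmod, hell⟩ γ lam mu => ?_⟩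
  · conv_rhs => rw [← h 1 lam mu, jacobiSlash_apply, h 1 0 0]
  · ext ⟨τ, z⟩
    rw [jacobiSlash_apply, hmod, hell]

theorem jacobiSlash_zero_zero_jacobiPullback (ψ : ℍ × (Fin N → ℂ) → ℂ)
    (s : Matrix (Fin N) (Fin M) ℤ) (γ : SL(2, ℤ)) :
    jacobiSlash k (gramPullback L s) (jacobiPullback ψ s) γ 0 0 =
      jacobiPullback (jacobiSlash k L ψ γ 0 0) s := by
  ext ⟨τ, z⟩
  simp only [jacobiPullback, jacobiSlash_zero_zero_apply, bilin_gramPullback, Matrix.mulVec_smul]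

/-- The conjugate of the translation by `v` under `S` is the translation by `τ v`. -/
theorem expTwoPiI_mul_apply_add_smul_of_jacobiSlash_S (hL : L.IsSymm)
    (hS : jacobiSlash k L φ ModularGroup.S 0 0 = φ) {v : Fin N → ℂ}
    (hv : ∀ τ z, φ (τ, z + v) = φ (τ, z)) (τ : ℍ) (z : Fin N → ℂ) :
    expTwoPiI (τ * bilin L v v / 2 + bilin L v z) * φ (τ, z + (τ : ℂ) • v) = φ (τ, z) := by
  have hτ : (τ : ℂ) ≠ 0 := τ.ne_zero
  have hS' (w : Fin N → ℂ) : φ (τ, w) = (τ : ℂ) ^ (-k) * expTwoPiI (-bilin L w w / (2 * τ)) *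
      φ (ModularGroup.S • τ, (τ : ℂ)⁻¹ • w) := by
    conv_lhs => rw [← hS, jacobiSlash_zero_zero_apply]
    simp [ModularGroup.S]
  have hexp : expTwoPiI (τ * bilin L v v / 2 + bilin L v z) *
      expTwoPiI (-bilin L (z + (τ : ℂ) • v) (z + (τ : ℂ) • v) / (2 * τ)) =
      expTwoPiI (-bilin L z z / (2 * τ)) := by
    rw [← expTwoPiI_add, bilin_add_smul_add_smul hL]
    congr 1
    field_simp
    ring
  rw [hS', hS' z, smul_add, smul_smul, inv_mul_cancel₀ hτ, one_smul, hv, ← hexp]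
  ring

end JacobiSlash

namespace IsJacobiForm

variable {N : ℕ} {k : ℤ} {L : Matrix (Fin N) (Fin N) ℤ} {φ : ℍ × (Fin N → ℂ) → ℂ}

theorem apply_add_intCast (h : IsJacobiForm k L φ) (τ : ℍ) (z : Fin N → ℂ) (m : Fin N → ℤ) :
    φ (τ, z + fun i => (m i : ℂ)) = φ (τ, z) := by
  simpa [bilin, expTwoPiI_zero, ← Pi.zero_def] using
    (forall_jacobiSlash_eq_iff.1 h.slash_eq).2 τ z 0 m

theorem apply_neg (h : IsJacobiForm k L φ) (τ : ℍ) (z : Fin N → ℂ) :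
    φ (τ, -z) = (-1) ^ k * φ (τ, z) := by
  have hsign : (-1 : ℂ) ^ (-k) = (-1) ^ k := by rw [zpow_neg, ← inv_zpow, inv_neg_one]
  conv_lhs => rw [← h.slash_eq (-1) 0 0, jacobiSlash_zero_zero_apply, ModularGroup.SL_neg_smul]
  simp [expTwoPiI_zero, hsign, -zpow_neg]

theorem apply_ofComplex_add_one (h : IsJacobiForm k L φ) {t : ℂ} (ht : 0 < t.im)
    (z : Fin N → ℂ) :
    φ (UpperHalfPlane.ofComplex (t + 1), z) = φ (UpperHalfPlane.ofComplex t, z) := by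
  have hT : UpperHalfPlane.ofComplex (t + 1) = ModularGroup.T • UpperHalfPlane.ofComplex t := by
    rw [UpperHalfPlane.modular_T_smul]
    ext1
    rw [UpperHalfPlane.coe_vadd, UpperHalfPlane.ofComplex_apply_of_im_pos ht,
      UpperHalfPlane.ofComplex_apply_of_im_pos (by simpa using ht)]
    simp [add_comm]
  conv_rhs => rw [← h.slash_eq ModularGroup.T 0 0, jacobiSlash_zero_zero_apply, ← hT]
  simp [ModularGroup.T, expTwoPiI_zero]

theorem isParabolicForm (h : IsJacobiForm k L φ) (hL : L.IsSymm) :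
    IsParabolicForm k L fun t z => φ (UpperHalfPlane.ofComplex t, z) where
  holo := h.holo
  add_one _ ht := funext (h.apply_ofComplex_add_one ht)
  intPeriodic _ _ := h.apply_add_intCast _
  elliptic t ht z lam := by
    have hell := (forall_jacobiSlash_eq_iff.1 h.slash_eq).2 (UpperHalfPlane.ofComplex t) z lam 0
    have ht' : (UpperHalfPlane.ofComplex t : ℂ) = t := by
      rw [UpperHalfPlane.ofComplex_apply_of_im_pos ht]
    rwa [h.apply_add_intCast, expTwoPiI_add, bilin_intCast, expTwoPiI_bilin_intCast hL,
      ht'] at hell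
  neg _ _ := h.apply_neg _
  bounded β := by
    obtain ⟨C, A, hC⟩ := UpperHalfPlane.isBoundedAtImInfty_iff.1 (h.growth 0 β)
    refine ⟨C, A, fun t hA ht => ?_⟩
    have hCt := hC (UpperHalfPlane.ofComplex t)
      (by rwa [UpperHalfPlane.ofComplex_apply_of_im_pos ht])
    simpa [bilin, expTwoPiI_zero, ← Pi.zero_def] using hCt

end IsJacobiForm

/-! ### Descent along integral maps -/

theorem isUnit_det_map_intCast {n K : Type*} [Fintype n] [DecidableEq n] [Field K] [CharZero K]
    {M : Matrix n n ℤ} (hM : M.det ≠ 0) : IsUnit (M.map (Int.cast : ℤ → K)).det := by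
  rw [isUnit_iff_ne_zero, ← Int.cast_det]
  exact Int.cast_ne_zero.2 hM

theorem isSymm_of_gramPullback {N : ℕ} {L st : Matrix (Fin N) (Fin N) ℤ} (hst : st.det ≠ 0)
    (h : (gramPullback L st).IsSymm) : L.IsSymm := by
  have hreg := Matrix.isRegular_of_isLeftRegular_det (IsRegular.of_ne_zero hst).left
  have hreg' := Matrix.isRegular_of_isLeftRegular_det (A := st.transpose)
    (IsRegular.of_ne_zero (st.det_transpose.trans_ne hst)).left
  refine hreg'.left (hreg.right ?_)
  simpa only [gramPullback, Matrix.IsSymm, Matrix.transpose_mul, Matrix.transpose_transpose,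
    Matrix.mul_assoc] using h

section Descent

variable {N : ℕ} {k : ℤ} {L st : Matrix (Fin N) (Fin N) ℤ} {ψ : ℍ × (Fin N → ℂ) → ℂ}

theorem jacobiPullback_injective (hst : st.det ≠ 0) :
    Function.Injective fun ψ => jacobiPullback ψ st := fun ψ ψ' h => by
  ext ⟨τ, z⟩
  obtain ⟨w, rfl⟩ := Matrix.mulVec_surjective_iff_isUnit.2
    ((Matrix.isUnit_iff_isUnit_det _).2 (isUnit_det_map_intCast hst)) z
  exact congrFun h (τ, w)

theorem differentiableOn_of_jacobiPullback (hst : st.det ≠ 0)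
    (h : DifferentiableOn ℂ (fun p : ℂ × (Fin N → ℂ) =>
      jacobiPullback ψ st (UpperHalfPlane.ofComplex p.1, p.2)) {p | 0 < p.1.im}) :
    DifferentiableOn ℂ (fun p : ℂ × (Fin N → ℂ) => ψ (UpperHalfPlane.ofComplex p.1, p.2))
      {p | 0 < p.1.im} := by
  have hlin : Differentiable ℂ fun p : ℂ × (Fin N → ℂ) =>
      (p.1, (st.map (Int.cast : ℤ → ℂ))⁻¹.mulVec p.2) :=
    differentiable_fst.prodMk
      (((st.map (Int.cast : ℤ → ℂ))⁻¹.mulVecLin.toContinuousLinearMap.differentiable).comp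
        differentiable_snd)
  refine (h.comp hlin.differentiableOn fun p hp => hp).congr fun p _ => ?_
  simp only [Function.comp_apply, jacobiPullback, Matrix.mulVec_mulVec,
    Matrix.mul_nonsing_inv _ (isUnit_det_map_intCast hst), Matrix.one_mulVec]

theorem isBoundedAtImInfty_of_jacobiPullback (hst : st.det ≠ 0)
    (h : ∀ α β : Fin N → ℚ, UpperHalfPlane.IsBoundedAtImInfty fun τ : ℍ =>
      expTwoPiI ((τ : ℂ) * bilin (gramPullback L st) (fun i => (α i : ℂ)) (fun i => (α i : ℂ)) / 2)
        * jacobiPullback ψ st (τ, fun i => (α i : ℂ) * (τ : ℂ) + (β i : ℂ)))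
    (α β : Fin N → ℚ) : UpperHalfPlane.IsBoundedAtImInfty fun τ : ℍ =>
      expTwoPiI ((τ : ℂ) * bilin L (fun i => (α i : ℂ)) (fun i => (α i : ℂ)) / 2) *
        ψ (τ, fun i => (α i : ℂ) * (τ : ℂ) + (β i : ℂ)) := by
  have hsurj := Matrix.mulVec_surjective_iff_isUnit.2
    ((Matrix.isUnit_iff_isUnit_det _).2 (isUnit_det_map_intCast (K := ℚ) hst))
  have hcast (v : Fin N → ℚ) : (st.map (Int.cast : ℤ → ℂ)).mulVec (fun i => (v i : ℂ)) =
      fun i => ((st.map (Int.cast : ℤ → ℚ)).mulVec v i : ℂ) := by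
    ext i
    simp [Matrix.mulVec, dotProduct]
  have hlin (a b : Fin N → ℂ) (τ : ℂ) : (fun i => a i * τ + b i) = τ • a + b := by
    ext i
    simp [mul_comm]
  obtain ⟨α, rfl⟩ := hsurj α
  obtain ⟨β, rfl⟩ := hsurj β
  simpa only [jacobiPullback, bilin_gramPullback, hlin, Matrix.mulVec_add, Matrix.mulVec_smul,
    hcast] using h α β

theorem IsJacobiForm.of_jacobiPullback
    (h : IsJacobiForm k (gramPullback L st) (jacobiPullback ψ st))
    (hL : (gramPullback L st).IsSymm) (hst : st.det ≠ 0)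
    (hψ : ∀ τ z (m : Fin N → ℤ), ψ (τ, z + fun i => (m i : ℂ)) = ψ (τ, z)) :
    IsJacobiForm k L ψ where
  holo := differentiableOn_of_jacobiPullback hst h.holo
  slash_eq := by
    have hmod (γ : SL(2, ℤ)) : jacobiSlash k L ψ γ 0 0 = ψ := jacobiPullback_injective hst <| by
      simp only [← jacobiSlash_zero_zero_jacobiPullback, h.slash_eq]
    refine forall_jacobiSlash_eq_iff.2 ⟨hmod, fun τ z lam mu => ?_⟩
    rw [hψ]
    exact expTwoPiI_mul_apply_add_smul_of_jacobiSlash_S (isSymm_of_gramPullback hst hL) (hmod _)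
      (fun τ z => hψ τ z lam) τ z
  growth := isBoundedAtImInfty_of_jacobiPullback hst h.growth

theorem IsJacobiForm.mem_jacobiFormsU {φ : ℍ × (Fin N → ℂ) → ℂ}
    (h : IsJacobiForm k (gramPullback L st) φ) (hL : (gramPullback L st).IsSymm)
    (hst : st.det ≠ 0)
    (hφ : ∀ τ z w (m : Fin N → ℤ),
      (st.map (Int.cast : ℤ → ℂ)).mulVec w = (fun i => (m i : ℂ)) → φ (τ, z + w) = φ (τ, z)) :
    φ ∈ jacobiFormsU k L st := by
  have hdet : IsUnit (st.map (Int.cast : ℤ → ℂ)).det := isUnit_det_map_intCast hst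
  have hpull : jacobiPullback (fun p => φ (p.1, (st.map (Int.cast : ℤ → ℂ))⁻¹.mulVec p.2)) st =
      φ := by
    ext ⟨τ, z⟩
    simp only [jacobiPullback, Matrix.mulVec_mulVec, Matrix.nonsing_inv_mul _ hdet,
      Matrix.one_mulVec]
  refine ⟨_, IsJacobiForm.of_jacobiPullback (hpull.symm ▸ h) hL hst fun τ z m => ?_, hpull⟩
  rw [Matrix.mulVec_add]
  refine hφ τ _ _ m ?_
  rw [Matrix.mulVec_mulVec, Matrix.mul_nonsing_inv _ hdet, Matrix.one_mulVec]

theorem apply_add_of_mem_jacobiFormsU {φ : ℍ × (Fin N → ℂ) → ℂ} (h : φ ∈ jacobiFormsU k L st)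
    {w : Fin N → ℂ} {m : Fin N → ℤ}
    (hw : (st.map (Int.cast : ℤ → ℂ)).mulVec w = fun i => (m i : ℂ)) (τ : ℍ) (z : Fin N → ℂ) :
    φ (τ, z + w) = φ (τ, z) := by
  obtain ⟨ψ, hψ, rfl⟩ := h
  simp only [jacobiPullback, Matrix.mulVec_add, hw]
  exact IsJacobiForm.apply_add_intCast hψ τ _ m

theorem periodic_of_jacobiPullback_colVec_mem {φ : ℍ × (Fin N → ℂ) → ℂ} {s : Fin N → ℤ}
    {m : Matrix (Fin 1) (Fin 1) ℤ} {c : ℤ} (hc : c ≠ 0)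
    (h : jacobiPullback φ (colVec s) ∈ jacobiFormsU k m !![c]) (τ : ℍ) :
    Function.Periodic (fun x : ℂ => φ (τ, x • fun i => (s i : ℂ))) (1 / c) := fun x => by
  have hcol (x : ℂ) : jacobiPullback φ (colVec s) (τ, fun _ => x) =
      φ (τ, x • fun i => (s i : ℂ)) := by
    simp only [jacobiPullback]
    congr 2
    ext i
    simp [Matrix.mulVec, dotProduct, colVec, mul_comm]
  have hw : ((!![c] : Matrix (Fin 1) (Fin 1) ℤ).map (Int.cast : ℤ → ℂ)).mulVec
      (fun _ => (1 / c : ℂ)) = fun i => ((1 : Fin 1 → ℤ) i : ℂ) := by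
    ext i
    fin_cases i
    simp [Matrix.mulVec, dotProduct, hc]
  simpa only [← hcol] using! apply_add_of_mem_jacobiFormsU h hw τ fun _ => x

end Descent

theorem mainTheorem5 {N : ℕ} (hN : 0 < N) (L L' st : Matrix (Fin N) (Fin N) ℤ)
    (hL : IsJacobiIndex L) (hL' : ∀ i, Even (L' i i)) (hLL' : L = gramPullback L' st) :
    (∃ S : Finset (Fin N → ℤ), IsOldformTestSet L st S) ∧
    ∀ S : Finset (Fin N → ℤ), IsOldformTestSet L st S →
      ∀ (k : ℤ) (φ : UpperHalfPlane × (Fin N → ℂ) → ℂ), φ ∈ jacobiForms k L → φ ≠ 0 →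
        (∀ s ∈ S, jacobiPullback φ (colVec s) ∈
          jacobiFormsU k (scalarIndex L st s) !![contentOf st s]) →
        φ ∈ jacobiFormsU k L' st := by
  have hst : st.det ≠ 0 := det_ne_zero_of_gramPullback (hLL' ▸ hL.det_ne_zero)
  refine ⟨hL.exists_isOldformTestSet hst, fun S hS k φ hφ _ hres => ?_⟩
  have hpar := IsJacobiForm.isParabolicForm hφ hL.symm
  have hinv (τ : ℍ) (z w : Fin N → ℂ) (m : Fin N → ℤ)
      (hw : (st.map (Int.cast : ℤ → ℂ)).mulVec w = fun i => (m i : ℂ)) :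
      φ (τ, z + w) = φ (τ, z) := by
    simpa only [UpperHalfPlane.ofComplex_apply] using
      hpar.comp_add_eq_of_isOldformTestSet hL hLL' hS (fun s hs t _ =>
        periodic_of_jacobiPullback_colVec_mem (hS.contentOf_ne_zero hs) (hres s hs) _)
        hw τ.im_pos z
  subst hLL'
  exact IsJacobiForm.mem_jacobiFormsU hφ hL.symm hst hinv
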